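/- **Terms.** Terms are built from variables, names and function symbols. For all $n$ there are tuples $(T_1,\dots,T_n)$ and projections, with rules $\pi^n_i((x_1,\dots,x_n))\to x_i$. The *private* symbols are $\mathsf{unseal},\mathsf{get\_entry},\mathsf{state},\mathsf{tpm},\mathsf{cpu},\mathsf{smram},\mathsf{drt},\mathsf{tpm\_ch},\mathsf{set\_pcr},\mathsf{is\_small},\mathsf{is\_big}$ and the constants $\mathsf{tpm\_acc},\mathsf{cpu\_acc},\mathsf{cpu\_tpm}$ and infinitely many program entry points, among them $T_{init},T_{pp},T_{stm}$. All other symbols are public; these include the channel $\mathsf{os}$, the register reset values $p_s$ and $p_d$, $\mathsf{true},\mathsf{false},\bot$ and the message tags. Write $\mathsf{chain}(v_0)=v_0$, $\mathsf{chain}(v_0,\dots,v_{i+1})=\mathsf h((\mathsf{chain}(v_0,\dots,v_i),v_{i+1}))$. **Theories.** $\mathcal E_{drt}$ consists of the projection rules and the following rules, where $S=\mathsf{state}(\mathsf{tpm}(p),\mathsf{cpu}(i,c),\mathsf{smram}(m,s),\mathsf{drt}(a,q,l))$, all letters are variables unless a restriction on them is stated, $S[p:=v]$ denotes $S$ with the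 component $p$ replaced by $v$, and only those of the inner terms $\mathsf{tpm}(\cdot),\mathsf{cpu}(\cdot),\mathsf{smram}(\cdot),\mathsf{drt}(\cdot)$ that a rule reads, changes or restricts need have the displayed form: $\mathsf{sdec}(\mathsf{senc}(x,k),k)\to x$; $\mathsf{unseal}(\mathsf{seal}(x,y),y)\to x$; $\mathsf{get\_entry}(\mathsf{prog}(x))\to x$; $\mathsf{pcr}(S)\to p$, $\mathsf{int}(S)\to i$, $\mathsf{cache}(S)\to c$, $\mathsf{stm}(S)\to m$, $\mathsf{smi}(S)\to s$, $\mathsf{init}(S)\to a$, $\mathsf{pp}(S)\to q$, $\mathsf{lock}(S)\to l$; $\mathsf{reset}(S,\mathsf{tpm\_acc},r)\to S[p:=r]$ for $r\in\{p_s,p_d\}$; $\mathsf{extend}(S,\mathsf{tpm\_acc},v)\to S[p:=\mathsf h((p,v))]$; $\mathsf{set\_pcr}(S,\mathsf{tpm\_acc},v)\to S[p:=v]$; $\mathsf{set\_int}(S,\mathsf{cpu\_acc},v)\to S[i:=v]$, and $\mathsf{set\_int}(S,z,v)\to S[i:=v]$ if $q=\mathsf{prog}(z)$, $l=\mathsf{true}$;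 $\mathsf{cache}(S,v)\to S[c:=v]$; $\mathsf{flush\_stm}(S)\to S[m:=c]$ if $l=\mathsf{false}$; $\mathsf{flush\_smi}(S)\to S[s:=c]$; $\mathsf{set\_init}(S,\mathsf{cpu\_acc},v)\to S[a:=v]$; $\mathsf{set\_pp}(S,t,v)\to S[q:=v]$ if $t=\mathsf{cpu\_acc}$, or $a=\mathsf{prog}(t)$, or $i=\mathsf{true},m=\mathsf{prog}(z_1),s=\mathsf{prog}(z_2),t=(z_1,z_2)$; $\mathsf{set\_lock}(S,t,v)\to S[l:=v]$ if $t=\mathsf{cpu\_acc}$, or $q=\mathsf{prog}(t)$, or $i=\mathsf{true},m=\mathsf{prog}(z_1),s=\mathsf{prog}(z_2),t=(z_1,z_2)$. For $b\in\mathbb N$, $\mathcal E^b_{drt}$ is $\mathcal E_{drt}$ together with $\mathsf{is\_small}(\mathsf{chain}(v_0,\dots,v_j))\to\mathsf{true}$ for $0\le j<b$, $v_0\in\{p_s,p_d\}$, and $\mathsf{is\_big}(\mathsf{chain}(v_0,\dots,v_{b+1}))\to\mathsf{true}$, where all other $v_j$ are variables. These theories are convergent; $T\!\downarrow$ is the normal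 form of $T$ and $U=_{\mathcal E}V$ means $U\!\downarrow=V\!\downarrow$. The symbols at the root of a left-hand side are called destructors. $M\vdash_{\mathcal E}T$ means that, up to $=_{\mathcal E}$, $T$ is obtained from $M$ by applying public symbols. **Processes.** $P::=0\mid P|P\mid\,!P\mid\mathsf{new}\,n;P\mid\mathsf{in}(U,A);P\mid\mathsf{out}(U,T);P\mid\mathsf{if}\,U=V\,\mathsf{then}\,P\,\mathsf{else}\,P\mid\mathsf{let}\,x=T\,\mathsf{in}\,P$, where a pattern $A$ is a variable, a test $=T$ or a tuple of patterns. A configuration $(N,M,\mathcal P)$ consists of the set of names in use, the set of terms made available to the attacker, and a multiset of processes. Restriction creates a name outside $N$; $\mathsf{if}$ compares modulo $\mathcal E$; $\mathsf{let}\,x=T$ proceeds, with $x$ replaced by $T\!\downarrow$, only if $T\!\downarrow$ contains no destructor; an output of $T$ on $U$ and an input with pattern $A$ on the same channel (modulo $\mathcal E$) synchronize with any matching substitution $\sigma$, $T=_{\mathcal E}A\sigma$, and $T$ is added to $M$ if $M\vdash_{\mathcal E}U$. We write $P\models_{\mathcal E}\mathsf{Att}(T)$ if for some closed process $Q$, without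 private symbols and without the restricted names of $P$, there is a run from $(N,\emptyset,\{P|Q\})$, $N$ being the set of free names of $P|Q$, to some $(N',M',\mathcal P')$ with $M'\vdash_{\mathcal E}T$. Further, $P\models_{\mathcal E}(\mathsf{Att}(T)\Rightarrow\Psi)$ means that, for all substitutions $\sigma$, $P\models_{\mathcal E}\mathsf{Att}(T\sigma)$ implies $\Psi\sigma$, where $\Psi$ is $\mathit{false}$ or an equation, the latter read modulo $\mathcal E$. **Protocol.** In patterns, tags and names that are already bound are tests; a missing $\mathsf{else}$ branch and a missing continuation are $0$. $\mathrm{RESET}=\mathsf{in}(ch,(\mathsf{reset\_req},n,x));\mathsf{let}\,y=\mathsf{reset}(x,\mathsf{tpm\_acc},rv)\,\mathsf{in}\,\mathsf{out}(ch,(\mathsf{reset\_resp},n,y))$. $\mathrm{EXT}=\mathsf{in}(ch,(\mathsf{extend\_req},n,x,v));\mathsf{let}\,y=\mathsf{extend}(x,\mathsf{tpm\_acc},v)\,\mathsf{in}\,\mathsf{out}(ch,(\mathsf{extend\_resp},n,y))$. $\mathrm{EXT}^b=\mathsf{in}(ch,(\mathsf{extend\_req},n,x,v));\mathsf{let}\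,p=\mathsf{pcr}(x)\,\mathsf{in}\,\mathsf{if}\,\mathsf{is\_small}(p)=\mathsf{true}\,\mathsf{then}\,(\mathsf{let}\,y=\mathsf{extend}(x,\mathsf{tpm\_acc},v)\,\mathsf{in}\,\mathsf{out}(ch,(\mathsf{extend\_resp},n,y)))\,\mathsf{else}\,(\mathsf{out}(\mathsf{os},(p,v));\mathsf{in}(\mathsf{os},p');\mathsf{if}\,\mathsf{is\_big}(p')=\mathsf{true}\,\mathsf{then}\,\mathsf{let}\,y=\mathsf{set\_pcr}(x,\mathsf{tpm\_acc},p')\,\mathsf{in}\,\mathsf{out}(ch,(\mathsf{extend\_resp},n,y)))$. $\mathrm{UNS}=\mathsf{in}(ch,(\mathsf{tag\_unseal},z));\mathsf{let}\,v=\mathsf{unseal}(z,\mathsf{pcr}(x))\,\mathsf{in}\,\mathsf{out}(ch,(\mathsf{tag\_plain},v))$. For a process $X$, $\mathrm{TPM}(X)=\,!\big((\mathsf{let}\,(ch,rv)=(\mathsf{cpu\_tpm},p_d)\,\mathsf{in}\,!\mathrm{RESET})\mid(\mathsf{let}\,(ch,rv)=(\mathsf{os},p_s)\,\mathsf{in}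\,!\mathrm{RESET})\big)\mid\,!\big((\mathsf{let}\,ch=\mathsf{cpu\_tpm}\,\mathsf{in}\,!X)\mid(\mathsf{let}\,ch=\mathsf{os}\,\mathsf{in}\,!X)\mid\,!\,\mathsf{in}(\mathsf{cpu\_tpm},(\mathsf{ext\_channel},ch));!X\big)\mid\,!\big(\mathsf{in}(\mathsf{os},x);\mathsf{if}\,\mathsf{lock}(x)=\mathsf{true}\,\mathsf{then}\,\mathsf{let}\,ch=\mathsf{tpm\_ch}(\mathsf{pp}(x))\,\mathsf{in}\,\mathrm{UNS}\,\mathsf{else}\,\mathsf{let}\,ch=\mathsf{os}\,\mathsf{in}\,\mathrm{UNS}\big)$. $\mathrm{CPU}=\,!\,\mathsf{in}(\mathsf{os},(\mathsf{drt\_req},i,q,x));\mathsf{if}\,\mathsf{lock}(x)=\mathsf{false}\,\mathsf{then}\,\mathsf{let}\,s_0'=\mathsf{set\_int}(x,\mathsf{cpu\_acc},\mathsf{false})\,\mathsf{in}\,\mathsf{let}\,s_0=\mathsf{set\_lock}(s_0',\mathsf{cpu\_acc},\mathsf{true})\,\mathsf{in}\,\mathsf{let}\,m=(\mathsf h(i),\mathsf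 h(\mathsf{stm}(x)))\,\mathsf{in}\,\mathsf{new}\,n;\mathsf{out}(\mathsf{cpu\_tpm},(\mathsf{reset\_req},n,s_0));\mathsf{in}(\mathsf{cpu\_tpm},(\mathsf{reset\_resp},n,s_1));\mathsf{out}(\mathsf{cpu\_tpm},(\mathsf{extend\_req},n,s_1,m));\mathsf{in}(\mathsf{cpu\_tpm},(\mathsf{extend\_resp},n,s_2));\mathsf{let}\,s_3=\mathsf{set\_init}(s_2,\mathsf{cpu\_acc},i)\,\mathsf{in}\,\mathsf{let}\,e=\mathsf{get\_entry}(i)\,\mathsf{in}\,\mathsf{out}(e,(n,s_3,\mathsf{tpm\_ch}(i),q));\mathsf{out}(\mathsf{cpu\_tpm},(\mathsf{ext\_channel},\mathsf{tpm\_ch}(i)));\mathsf{in}(e,(\mathsf{drt\_resp},n,s_4));\mathsf{let}\,e'=\mathsf{get\_entry}(\mathsf{pp}(s_4))\,\mathsf{in}\,\mathsf{out}(e',(s_4,\mathsf{tpm\_ch}(\mathsf{prog}(e'))));\mathsf{out}(\mathsf{cpu\_tpm},(\mathsf{ext\_channel},\mathsf{tpm\_ch}(\mathsf{prog}(e'))))$.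 $\mathrm{INIT}=\mathsf{out}(\mathsf{os},\mathsf{prog}(T_{init}));\mathsf{out}(\mathsf{os},\mathsf{prog}(T_{stm}));\mathsf{in}(T_{init},(n,x,c,q));\mathsf{let}\,m=\mathsf h(q)\,\mathsf{in}\,\mathsf{new}\,n_1;\mathsf{out}(c,(\mathsf{extend\_req},n_1,x,m));\mathsf{in}(c,(\mathsf{extend\_resp},n_1,x'));\mathsf{let}\,y=\mathsf{set\_pp}(x',T_{init},q)\,\mathsf{in}\,\mathsf{out}(T_{init},(\mathsf{drt\_resp},n,y));\mathsf{out}(\mathsf{os},y)$. $\mathrm{PP}=\mathsf{out}(\mathsf{os},\mathsf{prog}(T_{pp}));\mathsf{in}(T_{pp},(x_0,c));\mathsf{let}\,x=\mathsf{set\_int}(x_0,T_{pp},\mathsf{true})\,\mathsf{in}\,\mathsf{out}(\mathsf{os},x);\mathsf{in}(\mathsf{os},z);\mathsf{in}(\mathsf{os},w);\mathsf{out}(c,(\mathsf{tag\_unseal},z));\mathsf{in}(c,(\mathsf{tag\_plain},k));\mathsf{let}\,u=\mathsf{sdec}(w,k)\,\mathsf{in}\,\mathsf{out}(\mathsf{os},u);\mathsf{new}\,r;\mathsf{out}(c,(\mathsf{extend\_req},r,x,\bot));\mathsf{in}(c,(\mathsf{extend\_resp},r,x'));\mathsf{let}\,y=\mathsf{set\_lock}(x',T_{pp},\mathsf{false})\,\mathsf{in}\,\mathsf{out}(\mathsf{os},y)$.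 With $\mathsf{hchain}=\mathsf{chain}(p_d,(\mathsf h(\mathsf{prog}(T_{init})),\mathsf h(\mathsf{prog}(T_{stm}))),\mathsf h(\mathsf{prog}(T_{pp})))$: $\mathrm{DATA}=\mathsf{new}\,k_{pp};\mathsf{new}\,hi_{pp};\mathsf{out}(\mathsf{os},\mathsf{senc}(hi_{pp},k_{pp}));\mathsf{let}\,z=\mathsf{seal}(k_{pp},\mathsf{hchain})\,\mathsf{in}\,\mathsf{out}(\mathsf{os},z)$. $\mathrm{SETUP}=\mathsf{in}(\mathsf{os},m);\mathsf{in}(\mathsf{os},s);\mathsf{out}(\mathsf{os},\mathsf{state}(\mathsf{tpm}(p_s),\mathsf{cpu}(\mathsf{true},\bot),\mathsf{smram}(m,s),\mathsf{drt}(\bot,\bot,\mathsf{false})));\mathsf{in}(\mathsf{os},i);\mathsf{in}(\mathsf{os},q);\mathsf{in}(\mathsf{os},x);\mathsf{out}(\mathsf{os},(\mathsf{drt\_req},i,q,x))$. $\mathrm{EXEC}=\mathrm{CPU}\mid\,!\mathrm{INIT}\mid\mathrm{SETUP}\mid\mathrm{DATA}\mid\,!\mathrm{PP}$, $\mathrm{DRT}=\mathrm{TPM}(\mathrm{EXT})\mid\mathrm{EXEC}$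 and $\mathrm{DRT}^b=\mathrm{TPM}(\mathrm{EXT}^b)\mid\mathrm{EXEC}$. **Properties.** $\Phi_{sec}$ is $\mathsf{Att}(k_{pp})\Rightarrow\mathit{false}$, where $k_{pp}$ stands for any name created by the restriction of $k_{pp}$ in $\mathrm{DATA}$; $\Phi_{int}$ is $$\mathsf{Att}\big(\mathsf{state}(\mathsf{tpm}(\mathsf{hchain}),\mathsf{cpu}(x,y),\mathsf{smram}(x_{stm},x_{smi}),\mathsf{drt}(x_{init},x_{pp},\mathsf{true}))\big)\Rightarrow(x_{init},x_{pp},x_{stm})=(\mathsf{prog}(T_{init}),\mathsf{prog}(T_{pp}),\mathsf{prog}(T_{stm})).$$ **Theorem.** For every natural number $b\ge 2$ and every $\Phi\in\{\Phi_{sec},\Phi_{int}\}$, $$\mathrm{DRT}\models_{\mathcal E_{drt}}\Phi\quad\Longleftrightarrow\quad \mathrm{DRT}^b\models_{\mathcal E^b_{drt}}\Phi .$$ -/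

import Mathlib

namespace Drt

/-! ### Signature -/

/-- Function symbols. `entry i` are the private constants that serve as entry points of programs
(countably many, as there are countably many processes); `tup n` builds sequences of length `n` and
`proj n i` takes them apart; `cacheR` reads the cache and `cacheW` writes it. -/
inductive Sym
  -- public constants: channel, values, message tags
  | os | ps | pd | tt | ff | bot
  | reset_req | reset_resp | extend_req | extend_resp | ext_channel
  | tag_open | tag_plain | drt_req | drt_resp
  -- data
  | h | senc | sdec | sealData | unsealData
  | tup (n : ℕ) | proj (n : ℕ) (i : Fin n)
  -- programs
  | prog | get_entry | entry (i : ℕ)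
  -- platform state
  | state | tpm | cpu | smram | drt
  | tpm_acc | cpu_acc
  -- reading the state
  | pcr | int | cacheR | stm | smi | init | pp | lock
  -- writing the state
  | reset | extend | set_pcr | set_int | cacheW | flush_stm | flush_smi
  | set_init | set_pp | set_lock
  -- private channels
  | cpu_tpm | tpm_ch
  -- bounding the register
  | is_small | is_big
  deriving DecidableEq

@[reducible] def Sym.arity : Sym → ℕ
  | .h | .prog | .get_entry | .tpm | .tpm_ch | .is_small | .is_big => 1
  | .pcr | .int | .cacheR | .stm | .smi | .init | .pp | .lock => 1
  | .flush_stm | .flush_smi => 1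
  | .senc | .sdec | .sealData | .unsealData | .cpu | .smram | .cacheW => 2
  | .drt | .reset | .extend | .set_pcr | .set_int | .set_init | .set_pp | .set_lock => 3
  | .state => 4
  | .tup n => n
  | .proj _ _ => 1
  | _ => 0

/-- The private symbols; all the others are public. -/
def Sym.priv : Set Sym :=
  {f | (∃ i, f = .entry i) ∨
    f ∈ ({.unsealData, .get_entry, .state, .tpm, .cpu, .smram, .drt, .tpm_acc, .cpu_acc,
      .cpu_tpm, .tpm_ch, .set_pcr, .is_small, .is_big} : Set Sym)}

/-! ### Terms -/

/-- Variables: those used in the protocol, and infinitely many others. -/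
inductive Var
  | ch | rv | nonce | pf_state | new_st | v | blob | pcr | val | new_pcr
  | init | pp | s0' | s0 | measure | s1 | s2 | s3 | einit | new_state | epp
  | pf_st | tpmc | nonce1 | ext_st
  | pf_state0 | xblob | xenc | xk | mess | rand | exts | ends
  | kpp | hipp | sealed_key | xstm | xsmi | xint | xcache | xinit | xpp
  | other (n : ℕ)
  deriving DecidableEq

/-- The origin of a name: the attacker, or one of the name restrictions of the protocol. -/
inductive Label
  | att | kpp | hipp | nonce | nonce1 | rand
  deriving DecidableEq

/-- Names. The name that a restriction creates carries the label of the restriction, so that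
a restricted name can be referred to in a security property. -/
structure Name where
  label : Label
  idx : ℕ
  deriving DecidableEq

inductive Term
  | var (x : Var)
  | name (n : Name)
  | app (f : Sym) (args : Fin f.arity → Term)

abbrev Subst := Var → Term

def Term.subst (σ : Subst) : Term → Term
  | .var x => σ x
  | .name n => .name n
  | .app f args => .app f fun i => (args i).subst σ

/-- The free variables of a term. -/
def Term.fv : Term → Set Var
  | .var x => {x}
  | .name _ => ∅
  | .app _ args => ⋃ i, (args i).fv

/-- The names that occur in a term. -/
def Term.names : Term → Set Name
  | .var _ => ∅
  | .name n => {n}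
  | .app _ args => ⋃ i, (args i).names

/-- The function symbols that occur in a term. -/
def Term.sig : Term → Set Sym
  | .var _ => ∅
  | .name _ => ∅
  | .app f args => {f} ∪ ⋃ i, (args i).sig

namespace Term

abbrev os : Term := .app .os ![]
abbrev ps : Term := .app .ps ![]
abbrev pd : Term := .app .pd ![]
abbrev tt : Term := .app .tt ![]
abbrev ff : Term := .app .ff ![]
abbrev bot : Term := .app .bot ![]
abbrev reset_req : Term := .app .reset_req ![]
abbrev reset_resp : Term := .app .reset_resp ![]
abbrev extend_req : Term := .app .extend_req ![]
abbrev extend_resp : Term := .app .extend_resp ![]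
abbrev ext_channel : Term := .app .ext_channel ![]
abbrev tag_open : Term := .app .tag_open ![]
abbrev tag_plain : Term := .app .tag_plain ![]
abbrev drt_req : Term := .app .drt_req ![]
abbrev drt_resp : Term := .app .drt_resp ![]
abbrev h (t : Term) : Term := .app .h ![t]
abbrev senc (t k : Term) : Term := .app .senc ![t, k]
abbrev sdec (t k : Term) : Term := .app .sdec ![t, k]
abbrev sealData (t p : Term) : Term := .app .sealData ![t, p]
abbrev unsealData (t p : Term) : Term := .app .unsealData ![t, p]
abbrev tup {n : ℕ} (ts : Fin n → Term) : Term := .app (.tup n) ts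
abbrev proj {n : ℕ} (i : Fin n) (t : Term) : Term := .app (.proj n i) ![t]
abbrev prog (t : Term) : Term := .app .prog ![t]
abbrev get_entry (t : Term) : Term := .app .get_entry ![t]
abbrev entry (i : ℕ) : Term := .app (.entry i) ![]
/-- The entry points of the trusted programs. -/
abbrev Tinit : Term := entry 0
abbrev Tpp : Term := entry 1
abbrev Tstm : Term := entry 2
abbrev state (a b c d : Term) : Term := .app .state ![a, b, c, d]
abbrev tpm (a : Term) : Term := .app .tpm ![a]
abbrev cpu (a b : Term) : Term := .app .cpu ![a, b]
abbrev smram (a b : Term) : Term := .app .smram ![a, b]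
abbrev drt (a b c : Term) : Term := .app .drt ![a, b, c]
abbrev tpm_acc : Term := .app .tpm_acc ![]
abbrev cpu_acc : Term := .app .cpu_acc ![]
abbrev pcr (s : Term) : Term := .app .pcr ![s]
abbrev int (s : Term) : Term := .app .int ![s]
abbrev cacheR (s : Term) : Term := .app .cacheR ![s]
abbrev stm (s : Term) : Term := .app .stm ![s]
abbrev smi (s : Term) : Term := .app .smi ![s]
abbrev init (s : Term) : Term := .app .init ![s]
abbrev pp (s : Term) : Term := .app .pp ![s]
abbrev lock (s : Term) : Term := .app .lock ![s]
abbrev reset (s a v : Term) : Term := .app .reset ![s, a, v]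
abbrev extend (s a v : Term) : Term := .app .extend ![s, a, v]
abbrev set_pcr (s a v : Term) : Term := .app .set_pcr ![s, a, v]
abbrev set_int (s a v : Term) : Term := .app .set_int ![s, a, v]
abbrev cacheW (s v : Term) : Term := .app .cacheW ![s, v]
abbrev flush_stm (s : Term) : Term := .app .flush_stm ![s]
abbrev flush_smi (s : Term) : Term := .app .flush_smi ![s]
abbrev set_init (s a v : Term) : Term := .app .set_init ![s, a, v]
abbrev set_pp (s a v : Term) : Term := .app .set_pp ![s, a, v]
abbrev set_lock (s a v : Term) : Term := .app .set_lock ![s, a, v]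
abbrev cpu_tpm : Term := .app .cpu_tpm ![]
abbrev tpm_ch (t : Term) : Term := .app .tpm_ch ![t]
abbrev is_small (t : Term) : Term := .app .is_small ![t]
abbrev is_big (t : Term) : Term := .app .is_big ![t]

/-- `chain v₀ [v₁, …, vₙ] = h((… h((v₀, v₁)) …, vₙ))`. -/
def chain (v₀ : Term) (vs : List Term) : Term := vs.foldl (fun p v => h (tup ![p, v])) v₀

end Term

/-! ### Rewriting -/

/-- A theory is given by the instances `lσ → rσ` of its rewrite rules `l → r`: in the rules
below, the universally quantified terms play the role of the variables of the rule. -/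
abbrev Theory := Term → Term → Prop

/-- Rewriting in one step, in any context. -/
inductive Step (E : Theory) : Term → Term → Prop
  | root {l r : Term} : E l r → Step E l r
  | arg {f : Sym} {args : Fin f.arity → Term} {i : Fin f.arity} {t : Term} :
      Step E (args i) t → Step E (.app f args) (.app f (Function.update args i t))

/-- `W` is a normal form of `T`. -/
def IsNF (E : Theory) (T W : Term) : Prop :=
  Relation.ReflTransGen (Step E) T W ∧ ∀ W', ¬ Step E W W'

open Classical in
/-- The normal form of `T` (the theories below are convergent: it exists and is unique). -/
noncomputable def nf (E : Theory) (T : Term) : Term :=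
  if H : ∃ W, IsNF E T W then H.choose else T

/-- Equality modulo the theory. -/
def EqE (E : Theory) (U V : Term) : Prop := nf E U = nf E V

/-- Destructors are the symbols at the root of the left-hand sides of the rewrite rules. -/
def destructors (E : Theory) : Set Sym := {f | ∃ args r, E (.app f args) r}

/-- Deduction: what an attacker can compute from `S`. -/
inductive Ded (E : Theory) (S : Set Term) : Term → Prop
  | mem {T' T : Term} : T' ∈ S → EqE E T' T → Ded E S T
  | app {f : Sym} {args : Fin f.arity → Term} {T : Term} :
      f ∉ Sym.priv → (∀ i, Ded E S (args i)) → EqE E (.app f args) T → Ded E S T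

/-! ### The theories of the platform -/

open Term in
/-- Sequences. -/
inductive Etup : Theory
  | proj {n : ℕ} (i : Fin n) (ts : Fin n → Term) : Etup (proj i (tup ts)) (ts i)

open Term in
inductive Edata : Theory
  | sdec (v k : Term) : Edata (sdec (senc v k) k) v
  | unsealData (v p : Term) : Edata (unsealData (sealData v p) p) v

open Term in
inductive Eprog : Theory
  | get_entry (x : Term) : Eprog (get_entry (prog x)) x

open Term in
inductive Estate : Theory
  -- read access
  | pcr (y x₁ x₂ x₃ : Term) : Estate (pcr (state (tpm y) x₁ x₂ x₃)) y
  | int (x₁ y₁ y₂ x₂ x₃ : Term) : Estate (int (state x₁ (cpu y₁ y₂) x₂ x₃)) y₁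
  | cacheR (x₁ y₁ y₂ x₂ x₃ : Term) : Estate (cacheR (state x₁ (cpu y₁ y₂) x₂ x₃)) y₂
  | stm (x₁ x₂ y₁ y₂ x₃ : Term) : Estate (stm (state x₁ x₂ (smram y₁ y₂) x₃)) y₁
  | smi (x₁ x₂ y₁ y₂ x₃ : Term) : Estate (smi (state x₁ x₂ (smram y₁ y₂) x₃)) y₂
  | init (x₁ x₂ x₃ y₁ y₂ y₃ : Term) : Estate (init (state x₁ x₂ x₃ (drt y₁ y₂ y₃))) y₁
  | pp (x₁ x₂ x₃ y₁ y₂ y₃ : Term) : Estate (pp (state x₁ x₂ x₃ (drt y₁ y₂ y₃))) y₂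
  | lock (x₁ x₂ x₃ y₁ y₂ y₃ : Term) : Estate (lock (state x₁ x₂ x₃ (drt y₁ y₂ y₃))) y₃
  -- write access: the register
  | reset_ps (y x₁ x₂ x₃ : Term) :
      Estate (reset (state (tpm y) x₁ x₂ x₃) tpm_acc ps) (state (tpm ps) x₁ x₂ x₃)
  | reset_pd (y x₁ x₂ x₃ : Term) :
      Estate (reset (state (tpm y) x₁ x₂ x₃) tpm_acc pd) (state (tpm pd) x₁ x₂ x₃)
  | extend (y x₁ x₂ x₃ v : Term) :
      Estate (extend (state (tpm y) x₁ x₂ x₃) tpm_acc v)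
        (state (tpm (h (tup ![y, v]))) x₁ x₂ x₃)
  | set_pcr (y x₁ x₂ x₃ v : Term) :
      Estate (set_pcr (state (tpm y) x₁ x₂ x₃) tpm_acc v) (state (tpm v) x₁ x₂ x₃)
  -- write access: interrupts
  | set_int_cpu (x₁ y₁ y₂ x₂ x₃ v : Term) :
      Estate (set_int (state x₁ (cpu y₁ y₂) x₂ x₃) cpu_acc v) (state x₁ (cpu v y₂) x₂ x₃)
  | set_int_pp (x₁ y z x₂ z₁ z₂ v : Term) :
      Estate (set_int (state x₁ (cpu y z) x₂ (drt z₁ (prog z₂) tt)) z₂ v)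
        (state x₁ (cpu v z) x₂ (drt z₁ (prog z₂) tt))
  -- write access: cache
  | cacheW (x₁ y₁ y₂ x₂ x₃ v : Term) :
      Estate (cacheW (state x₁ (cpu y₁ y₂) x₂ x₃) v) (state x₁ (cpu y₁ v) x₂ x₃)
  | flush_stm (x₁ y₁ v z₁ z₂ w₁ w₂ : Term) :
      Estate (flush_stm (state x₁ (cpu y₁ v) (smram z₁ z₂) (drt w₁ w₂ ff)))
        (state x₁ (cpu y₁ v) (smram v z₂) (drt w₁ w₂ ff))
  | flush_smi (x₁ y₁ v z₁ z₂ x₂ : Term) :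
      Estate (flush_smi (state x₁ (cpu y₁ v) (smram z₁ z₂) x₂))
        (state x₁ (cpu y₁ v) (smram z₁ v) x₂)
  -- write access: loaded programs and lock
  | set_init (x₁ x₂ x₃ y₁ y₂ y₃ v : Term) :
      Estate (set_init (state x₁ x₂ x₃ (drt y₁ y₂ y₃)) cpu_acc v) (state x₁ x₂ x₃ (drt v y₂ y₃))
  | set_pp_cpu (x₁ x₂ x₃ y₁ y₂ y₃ v : Term) :
      Estate (set_pp (state x₁ x₂ x₃ (drt y₁ y₂ y₃)) cpu_acc v) (state x₁ x₂ x₃ (drt y₁ v y₃))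
  | set_pp_init (x₁ x₂ x₃ y₁ y₂ y₃ v : Term) :
      Estate (set_pp (state x₁ x₂ x₃ (drt (prog y₁) y₂ y₃)) y₁ v)
        (state x₁ x₂ x₃ (drt (prog y₁) v y₃))
  | set_pp_smi (x z z₁ z₂ y₁ y₂ y₃ v : Term) :
      Estate (set_pp (state x (cpu tt z) (smram (prog z₁) (prog z₂)) (drt y₁ y₂ y₃))
          (tup ![z₁, z₂]) v)
        (state x (cpu tt z) (smram (prog z₁) (prog z₂)) (drt y₁ v y₃))
  | set_lock_cpu (x₁ x₂ x₃ y₁ y₂ y₃ v : Term) :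
      Estate (set_lock (state x₁ x₂ x₃ (drt y₁ y₂ y₃)) cpu_acc v) (state x₁ x₂ x₃ (drt y₁ y₂ v))
  | set_lock_pp (x₁ x₂ x₃ y₁ y₂ y₃ v : Term) :
      Estate (set_lock (state x₁ x₂ x₃ (drt y₁ (prog y₂) y₃)) y₂ v)
        (state x₁ x₂ x₃ (drt y₁ (prog y₂) v))
  | set_lock_smi (x z z₁ z₂ y₁ y₂ y₃ v : Term) :
      Estate (set_lock (state x (cpu tt z) (smram (prog z₁) (prog z₂)) (drt y₁ y₂ y₃))
          (tup ![z₁, z₂]) v)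
        (state x (cpu tt z) (smram (prog z₁) (prog z₂)) (drt y₁ y₂ v))

open Term in
/-- A register is small if it records fewer than `b` extensions of `ps` or `pd`, and a term is big
if it is a chain of at least `b + 1` extensions. -/
inductive Ebound (b : ℕ) : Theory
  | small_ps (vs : List Term) : vs.length < b → Ebound b (is_small (chain ps vs)) tt
  | small_pd (vs : List Term) : vs.length < b → Ebound b (is_small (chain pd vs)) tt
  | big (v₀ : Term) (vs : List Term) : vs.length = b + 1 → Ebound b (is_big (chain v₀ vs)) tt

/-- The theory of the platform. -/
def Edrt : Theory := fun l r => Etup l r ∨ Edata l r ∨ Eprog l r ∨ Estate l r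

/-- The theory of the platform with bounded extensions. -/
def Edrtb (b : ℕ) : Theory := fun l r => Edrt l r ∨ Ebound b l r

/-! ### Processes -/

/-- Input patterns: a variable to be bound, a term that has to be matched, or a sequence of
patterns. -/
inductive Pat
  | bind (x : Var)
  | eq (t : Term)
  | tup {n : ℕ} (ps : Fin n → Pat)

/-- The variables that a pattern binds. -/
def Pat.bv : Pat → Finset Var
  | .bind x => {x}
  | .eq _ => ∅
  | .tup ps => Finset.univ.biUnion fun i => (ps i).bv

/-- The pattern as a term. -/
def Pat.toTerm : Pat → Term
  | .bind x => .var x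
  | .eq t => t
  | .tup ps => Term.tup fun i => (ps i).toTerm

def Pat.subst (σ : Subst) : Pat → Pat
  | .bind x => .bind x
  | .eq t => .eq (t.subst σ)
  | .tup ps => .tup fun i => (ps i).subst σ

/-- Processes. In `new l x P` the variable `x` stands for the restricted name in `P`, and `l` is
its label. -/
inductive Proc
  | nil
  | par (P Q : Proc)
  | repl (P : Proc)
  | new (l : Label) (x : Var) (P : Proc)
  | inp (U : Term) (A : Pat) (P : Proc)
  | out (U T : Term) (P : Proc)
  | ite (U V : Term) (P Q : Proc)
  | letin (x : Var) (T : Term) (P : Proc)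

/-- `σ` without its action on the variables in `s`. -/
def Subst.drop (σ : Subst) (s : Finset Var) : Subst := fun x => if x ∈ s then .var x else σ x

/-- The substitution `[x ↦ T]`. -/
def Subst.single (x : Var) (T : Term) : Subst := fun y => if y = x then T else .var y

/-- Substitution in processes. It is only ever applied to closed terms, so that no variable can
be captured. -/
def Proc.subst (σ : Subst) : Proc → Proc
  | .nil => .nil
  | .par P Q => .par (P.subst σ) (Q.subst σ)
  | .repl P => .repl (P.subst σ)
  | .new l x P => .new l x (P.subst (σ.drop {x}))
  | .inp U A P => .inp (U.subst σ) (A.subst (σ.drop A.bv)) (P.subst (σ.drop A.bv))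
  | .out U T P => .out (U.subst σ) (T.subst σ) (P.subst σ)
  | .ite U V P Q => .ite (U.subst σ) (V.subst σ) (P.subst σ) (Q.subst σ)
  | .letin x T P => .letin x (T.subst σ) (P.subst (σ.drop {x}))

/-- The free variables of a process. -/
def Proc.fv : Proc → Set Var
  | .nil => ∅
  | .par P Q => P.fv ∪ Q.fv
  | .repl P => P.fv
  | .new _ x P => P.fv \ {x}
  | .inp U A P => U.fv ∪ ((A.toTerm.fv ∪ P.fv) \ A.bv)
  | .out U T P => U.fv ∪ T.fv ∪ P.fv
  | .ite U V P Q => U.fv ∪ V.fv ∪ P.fv ∪ Q.fv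
  | .letin x T P => T.fv ∪ (P.fv \ {x})

/-- The names that occur in a process; they are free, since restrictions bind variables. -/
def Proc.names : Proc → Set Name
  | .nil => ∅
  | .par P Q => P.names ∪ Q.names
  | .repl P => P.names
  | .new _ _ P => P.names
  | .inp U A P => U.names ∪ A.toTerm.names ∪ P.names
  | .out U T P => U.names ∪ T.names ∪ P.names
  | .ite U V P Q => U.names ∪ V.names ∪ P.names ∪ Q.names
  | .letin _ T P => T.names ∪ P.names

/-- The function symbols of a pattern, apart from those that build its sequences, which are
public. -/
def Pat.sig : Pat → Set Sym
  | .bind _ => ∅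
  | .eq t => t.sig
  | .tup ps => ⋃ i, (ps i).sig

/-- The function symbols of a process. -/
def Proc.sig : Proc → Set Sym
  | .nil => ∅
  | .par P Q => P.sig ∪ Q.sig
  | .repl P => P.sig
  | .new _ _ P => P.sig
  | .inp U A P => U.sig ∪ A.sig ∪ P.sig
  | .out U T P => U.sig ∪ T.sig ∪ P.sig
  | .ite U V P Q => U.sig ∪ V.sig ∪ P.sig ∪ Q.sig
  | .letin _ T P => T.sig ∪ P.sig

/-- The labels of the restrictions in a process. -/
def Proc.labels : Proc → Set Label
  | .nil => ∅
  | .par P Q => P.labels ∪ Q.labels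
  | .repl P => P.labels
  | .new l _ P => {l} ∪ P.labels
  | .inp _ _ P => P.labels
  | .out _ _ P => P.labels
  | .ite _ _ P Q => P.labels ∪ Q.labels
  | .letin _ _ P => P.labels

/-- A configuration: the names in use, the terms made available to the attacker, and the processes
running in parallel. -/
structure Config where
  names : Set Name
  know : Set Term
  procs : Multiset Proc

/-- The operational semantics. Messages and values of `let` are substituted in normal form; all
comparisons of terms are modulo the theory. A message sent on a channel becomes available to the
attacker if the latter can deduce the channel. -/
inductive Red (E : Theory) : Config → Config → Prop
  | nil {N M Ps} : Red E ⟨N, M, .nil ::ₘ Ps⟩ ⟨N, M, Ps⟩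
  | bang {N M Ps P} : Red E ⟨N, M, .repl P ::ₘ Ps⟩ ⟨N, M, P ::ₘ .repl P ::ₘ Ps⟩
  | par {N M Ps P Q} : Red E ⟨N, M, .par P Q ::ₘ Ps⟩ ⟨N, M, P ::ₘ Q ::ₘ Ps⟩
  | new {N M Ps l x P} {n : Name} : n.label = l → n ∉ N →
      Red E ⟨N, M, .new l x P ::ₘ Ps⟩
        ⟨N ∪ {n}, M, P.subst (Subst.single x (.name n)) ::ₘ Ps⟩
  | comm {N M Ps U T P U' A Q} {σ : Subst} : EqE E U U' →
      (∀ x ∈ A.bv, nf E (σ x) = σ x) → (∀ x ∉ A.bv, σ x = .var x) →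
      EqE E T (A.toTerm.subst σ) →
      Red E ⟨N, M, .out U T P ::ₘ .inp U' A Q ::ₘ Ps⟩
        ⟨N, M ∪ {T' | T' = T ∧ Ded E M U}, P ::ₘ Q.subst σ ::ₘ Ps⟩
  | ite_true {N M Ps U V P Q} : EqE E U V →
      Red E ⟨N, M, .ite U V P Q ::ₘ Ps⟩ ⟨N, M, P ::ₘ Ps⟩
  | ite_false {N M Ps U V P Q} : ¬ EqE E U V →
      Red E ⟨N, M, .ite U V P Q ::ₘ Ps⟩ ⟨N, M, Q ::ₘ Ps⟩
  | letin {N M Ps x T P} : Disjoint (nf E T).sig (destructors E) →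
      Red E ⟨N, M, .letin x T P ::ₘ Ps⟩
        ⟨N, M, P.subst (Subst.single x (nf E T)) ::ₘ Ps⟩

/-- Attacker processes: closed processes without private symbols and without the restricted names
of the protocol. -/
def Attacker (Q : Proc) : Prop :=
  Q.fv = ∅ ∧ Q.sig ∩ Sym.priv = ∅ ∧ (∀ n ∈ Q.names, n.label = .att) ∧ ∀ l ∈ Q.labels, l = .att

/-- `P ⊨ Att(T)`: an attacker can learn `T` by interacting with `P`. -/
def Att (E : Theory) (P : Proc) (T : Term) : Prop :=
  ∃ Q, Attacker Q ∧ ∃ C : Config,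
    Relation.ReflTransGen (Red E) ⟨(Proc.par P Q).names, ∅, {.par P Q}⟩ C ∧ Ded E C.know T

/-- Correspondence assertions `Att(T) ⟹ false` (`concl = none`) and `Att(T) ⟹ U = V`
(`concl = some (U, V)`). -/
structure Assertion where
  prem : Term
  concl : Option (Term × Term)

/-- `Φσ` for the conclusion `Φ` of an assertion. -/
def holdsConcl (E : Theory) (σ : Subst) : Option (Term × Term) → Prop
  | none => False
  | some (U, V) => EqE E (U.subst σ) (V.subst σ)

/-- `P` satisfies an assertion. -/
def SatAssertion (E : Theory) (P : Proc) (A : Assertion) : Prop :=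
  ∀ σ : Subst, Att E P (A.prem.subst σ) → holdsConcl E σ A.concl

/-- A property is a family of correspondence assertions, all of which have to be satisfied. -/
abbrev Property := Set Assertion

def Sat (E : Theory) (P : Proc) (Φ : Property) : Prop := ∀ A ∈ Φ, SatAssertion E P A

/-! ### The protocol -/

abbrev V (x : Var) : Term := .var x

/-- Reset requests on `ch`, with reset value `rv`. -/
def pcrReset : Proc :=
  .inp (V .ch) (.tup ![.eq .reset_req, .bind .nonce, .bind .pf_state]) <|
  .letin .new_st (.reset (V .pf_state) .tpm_acc (V .rv)) <|
  .out (V .ch) (.tup ![.reset_resp, V .nonce, V .new_st]) .nil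

def tpmReset : Proc :=
  .par
    (.letin .ch .cpu_tpm <| .letin .rv .pd <| .repl pcrReset)
    (.letin .ch .os <| .letin .rv .ps <| .repl pcrReset)

def pcrExtend : Proc :=
  .inp (V .ch) (.tup ![.eq .extend_req, .bind .nonce, .bind .pf_state, .bind .v]) <|
  .letin .new_st (.extend (V .pf_state) .tpm_acc (V .v)) <|
  .out (V .ch) (.tup ![.extend_resp, V .nonce, V .new_st]) .nil

def pcrExtendSmall : Proc :=
  .letin .new_st (.extend (V .pf_state) .tpm_acc (V .val)) <|
  .out (V .ch) (.tup ![.extend_resp, V .nonce, V .new_st]) .nil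

def pcrExtendBig : Proc :=
  .out .os (.tup ![V .pcr, V .val]) <|
  .inp .os (.bind .new_pcr) <|
  .ite (.is_big (V .new_pcr)) .tt
    (.letin .new_st (.set_pcr (V .pf_state) .tpm_acc (V .new_pcr)) <|
      .out (V .ch) (.tup ![.extend_resp, V .nonce, V .new_st]) .nil)
    .nil

def pcrExtendB : Proc :=
  .inp (V .ch) (.tup ![.eq .extend_req, .bind .nonce, .bind .pf_state, .bind .val]) <|
  .letin .pcr (.pcr (V .pf_state)) <|
  .ite (.is_small (V .pcr)) .tt pcrExtendSmall pcrExtendBig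

def tpmExtend (ext : Proc) : Proc :=
  .par (.letin .ch .cpu_tpm <| .repl ext) <|
  .par (.letin .ch .os <| .repl ext) <|
  .repl (.inp .cpu_tpm (.tup ![.eq .ext_channel, .bind .ch]) <| .repl ext)

def unsealProc : Proc :=
  .inp (V .ch) (.tup ![.eq .tag_open, .bind .blob]) <|
  .letin .v (.unsealData (V .blob) (.pcr (V .pf_state))) <|
  .out (V .ch) (.tup ![.tag_plain, V .v]) .nil

def tpmUnseal : Proc :=
  .inp .os (.bind .pf_state) <|
  .ite (.lock (V .pf_state)) .tt
    (.letin .ch (.tpm_ch (.pp (V .pf_state))) unsealProc)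
    (.letin .ch .os unsealProc)

/-- The trusted platform module whose extension requests are handled by `ext`. -/
def tpmProc (ext : Proc) : Proc :=
  .par (.repl tpmReset) <| .par (.repl (tpmExtend ext)) (.repl tpmUnseal)

def cpuProc : Proc :=
  .repl <|
  .inp .os (.tup ![.eq .drt_req, .bind .init, .bind .pp, .bind .pf_state]) <|
  .ite (.lock (V .pf_state)) .ff
    (.letin .s0' (.set_int (V .pf_state) .cpu_acc .ff) <|
    .letin .s0 (.set_lock (V .s0') .cpu_acc .tt) <|
    .letin .measure (.tup ![.h (V .init), .h (.stm (V .pf_state))]) <|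
    .new .nonce .nonce <|
    .out .cpu_tpm (.tup ![.reset_req, V .nonce, V .s0]) <|
    .inp .cpu_tpm (.tup ![.eq .reset_resp, .eq (V .nonce), .bind .s1]) <|
    .out .cpu_tpm (.tup ![.extend_req, V .nonce, V .s1, V .measure]) <|
    .inp .cpu_tpm (.tup ![.eq .extend_resp, .eq (V .nonce), .bind .s2]) <|
    .letin .s3 (.set_init (V .s2) .cpu_acc (V .init)) <|
    .letin .einit (.get_entry (V .init)) <|
    .out (V .einit) (.tup ![V .nonce, V .s3, .tpm_ch (V .init), V .pp]) <|
    .out .cpu_tpm (.tup ![.ext_channel, .tpm_ch (V .init)]) <|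
    .inp (V .einit) (.tup ![.eq .drt_resp, .eq (V .nonce), .bind .new_state]) <|
    .letin .epp (.get_entry (.pp (V .new_state))) <|
    .out (V .epp) (.tup ![V .new_state, .tpm_ch (.prog (V .epp))]) <|
    .out .cpu_tpm (.tup ![.ext_channel, .tpm_ch (.prog (V .epp))]) .nil)
    .nil

/-- The trusted loader. -/
def initProc : Proc :=
  .out .os (.prog .Tinit) <|
  .out .os (.prog .Tstm) <|
  .inp .Tinit (.tup ![.bind .nonce, .bind .pf_st, .bind .tpmc, .bind .pp]) <|
  .letin .measure (.h (V .pp)) <|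
  .new .nonce1 .nonce1 <|
  .out (V .tpmc) (.tup ![.extend_req, V .nonce1, V .pf_st, V .measure]) <|
  .inp (V .tpmc) (.tup ![.eq .extend_resp, .eq (V .nonce1), .bind .ext_st]) <|
  .letin .new_st (.set_pp (V .ext_st) .Tinit (V .pp)) <|
  .out .Tinit (.tup ![.drt_resp, V .nonce, V .new_st]) <|
  .out .os (V .new_st) .nil

/-- The trusted protected program. -/
def ppProc : Proc :=
  .out .os (.prog .Tpp) <|
  .inp .Tpp (.tup ![.bind .pf_state0, .bind .tpmc]) <|
  .letin .pf_st (.set_int (V .pf_state0) .Tpp .tt) <|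
  .out .os (V .pf_st) <|
  .inp .os (.bind .xblob) <|
  .inp .os (.bind .xenc) <|
  .out (V .tpmc) (.tup ![.tag_open, V .xblob]) <|
  .inp (V .tpmc) (.tup ![.eq .tag_plain, .bind .xk]) <|
  .letin .mess (.sdec (V .xenc) (V .xk)) <|
  .out .os (V .mess) <|
  .new .rand .rand <|
  .out (V .tpmc) (.tup ![.extend_req, V .rand, V .pf_st, .bot]) <|
  .inp (V .tpmc) (.tup ![.eq .extend_resp, .eq (V .rand), .bind .exts]) <|
  .letin .ends (.set_lock (V .exts) .Tpp .ff) <|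
  .out .os (V .ends) .nil

/-- The value of the register that records the trusted programs. -/
abbrev hchain : Term :=
  Term.chain .pd
    [.tup ![.h (.prog .Tinit), .h (.prog .Tstm)], .h (.prog .Tpp)]

def dataProc : Proc :=
  .new .kpp .kpp <|
  .new .hipp .hipp <|
  .out .os (.senc (V .hipp) (V .kpp)) <|
  .letin .sealed_key (.sealData (V .kpp) hchain) <|
  .out .os (V .sealed_key) .nil

def setupProc : Proc :=
  .inp .os (.bind .xstm) <|
  .inp .os (.bind .xsmi) <|
  .out .os (.state (.tpm .ps) (.cpu .tt .bot) (.smram (V .xstm) (V .xsmi))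
    (.drt .bot .bot .ff)) <|
  .inp .os (.bind .init) <|
  .inp .os (.bind .pp) <|
  .inp .os (.bind .pf_state) <|
  .out .os (.tup ![.drt_req, V .init, V .pp, V .pf_state]) .nil

def execProc : Proc :=
  .par cpuProc <| .par (.repl initProc) <| .par setupProc <| .par dataProc (.repl ppProc)

/-- The process `DRT`. -/
def DRT : Proc := .par (tpmProc pcrExtend) execProc

/-- The process `DRT^b`; the bound only enters through the theory `Edrtb b`. -/
def DRTb : Proc := .par (tpmProc pcrExtendB) execProc

/-! ### Security properties -/

/-- Secrecy of the sealed key: no name created by the restriction of `k_pp` can be learnt. -/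
def PhiSec : Property := {A | ∃ i, A = ⟨.name ⟨.kpp, i⟩, none⟩}

/-- Code integrity. -/
def PhiInt : Property :=
  {⟨.state (.tpm hchain) (.cpu (V .xint) (V .xcache)) (.smram (V .xstm) (V .xsmi))
      (.drt (V .xinit) (V .xpp) .tt),
    some (.tup ![V .xinit, V .xpp, V .xstm],
      .tup ![.prog .Tinit, .prog .Tpp, .prog .Tstm])⟩}

end Drt

/-!
Both sides of the equivalence hold, because one invariant is preserved by every run of either
protocol: each channel carries only messages of a fixed type, and the terms that the attacker
obtains are `Public`. No name created for the key is `Public`, and a state whose register is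
`hchain` is `Public` only if the trusted programs are loaded. For the latter to be invariant, no
`Public` state may have `p_d`, or the value after the measurement of the trusted loader, as its
register, since the attacker could extend these values up to `hchain`. In the bounded protocol the
attacker may replace the register by any big value. As `2 ≤ b`, the two values above are small, so
that the platform itself computes the extensions of an honest launch, and none of the values on the
way to `hchain` is big.
-/

namespace Drt

/-! ### Normal forms in constructor theories -/

section Rewriting

variable {E : Theory}

/-- Theories whose rules are deterministic, are applied to function applications, and only look
at and rebuild terms through symbols that are not destructors. The last two clauses express this
without mentioning rule schemes: rule instances are stable under the maps, and preserve the
predicates, that are compatible with all the other symbols. -/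
structure IsConstructorTheory (E : Theory) : Prop where
  isApp {l r : Term} : E l r → ∃ f a, l = .app f a
  unique {l r r' : Term} : E l r → E l r' → r = r'
  map {φ : Term → Term} (hφ : ∀ f ∉ destructors E, ∀ a, φ (.app f a) = .app f (φ ∘ a))
    {f : Sym} {a : Fin f.arity → Term} {r : Term} :
    E (.app f a) r → E (.app f (φ ∘ a)) (φ r)
  preserves {X : Term → Prop} (hX : ∀ f ∉ destructors E, ∀ a, X (.app f a) ↔ ∀ i, X (a i))
    {f : Sym} {a : Fin f.arity → Term} {r : Term} :
    E (.app f a) r → (∀ i, X (a i)) → X r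

open Classical in
/-- The result of a rule at the root of a term, or the term itself if no rule applies. -/
noncomputable def rootStep (E : Theory) (t : Term) : Term :=
  if H : ∃ r, E t r then H.choose else t

/-- Innermost evaluation, with at most one step at each position. In a constructor theory it
computes the normal form. -/
noncomputable def eval (E : Theory) : Term → Term
  | .var x => .var x
  | .name n => .name n
  | .app f a => rootStep E (.app f fun i => eval E (a i))

/-- Terms in which no rule applies at any position. -/
def Irreducible (E : Theory) : Term → Prop
  | .app f a => (∀ i, Irreducible E (a i)) ∧ ∀ r, ¬ E (.app f a) r
  | _ => True

theorem rootStep_cases (E : Theory) (t : Term) :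
    E t (rootStep E t) ∨ (∀ r, ¬ E t r) ∧ rootStep E t = t := by
  by_cases h : ∃ r, E t r
  · rw [rootStep, dif_pos h]
    exact .inl h.choose_spec
  · exact .inr ⟨not_exists.1 h, dif_neg h⟩

theorem eval_app_of_not_mem_destructors {f : Sym} (hf : f ∉ destructors E)
    (a : Fin f.arity → Term) : eval E (.app f a) = .app f (eval E ∘ a) := by
  rw [eval]
  exact ((rootStep_cases E _).resolve_left fun h => hf ⟨_, _, h⟩).2

theorem steps_arg {f : Sym} (a : Fin f.arity → Term) (i : Fin f.arity) {t : Term}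
    (H : Relation.ReflTransGen (Step E) (a i) t) :
    Relation.ReflTransGen (Step E) (.app f a) (.app f (Function.update a i t)) := by
  induction H with
  | refl => simpa using .refl
  | @tail u v _ h ih =>
    have := Step.arg (args := Function.update a i u) (i := i) (t := v) (by simpa)
    exact ih.tail (by simpa using this)

theorem steps_args {f : Sym} {a a' : Fin f.arity → Term}
    (H : ∀ i, Relation.ReflTransGen (Step E) (a i) (a' i)) :
    Relation.ReflTransGen (Step E) (.app f a) (.app f a') := by
  have rewrite_on (s : Finset (Fin f.arity)) :
      Relation.ReflTransGen (Step E) (.app f a) (.app f (s.piecewise a' a)) := by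
    induction s using Finset.induction_on with
    | empty => simpa using .refl
    | insert i s hi ih =>
      rw [Finset.piecewise_insert]
      exact ih.trans (steps_arg _ _ (by simpa [hi] using H i))
  simpa using rewrite_on Finset.univ

theorem steps_eval (t : Term) : Relation.ReflTransGen (Step E) t (eval E t) := by
  induction t with
  | var x => exact .refl
  | name n => exact .refl
  | app f a ih =>
    refine (steps_args ih).trans ?_
    rw [eval]
    rcases rootStep_cases E (.app f fun i => eval E (a i)) with h | ⟨-, h⟩
    · exact .single (.root h)
    · rw [h]

theorem Irreducible.eval_eq {t : Term} (H : Irreducible E t) : eval E t = t := by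
  induction t with
  | var x => rfl
  | name n => rfl
  | app f a ih =>
    rw [eval, funext fun i => ih i (H.1 i)]
    exact ((rootStep_cases E _).resolve_left (H.2 _)).2

theorem irreducible_of_not_step {t : Term} (H : ∀ t', ¬ Step E t t') : Irreducible E t := by
  induction t with
  | var x => trivial
  | name n => trivial
  | app f a ih =>
    exact ⟨fun i => ih i fun t' h => H _ (.arg h), fun r h => H _ (.root h)⟩

namespace IsConstructorTheory

variable (hE : IsConstructorTheory E)

include hE

theorem rootStep_eq {l r : Term} (H : E l r) : rootStep E l = r := by
  have h : ∃ r, E l r := ⟨r, H⟩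
  rw [rootStep, dif_pos h]
  exact hE.unique h.choose_spec H

theorem eval_eq_of_step {t t' : Term} (H : Step E t t') : eval E t = eval E t' := by
  induction H with
  | root h =>
    obtain ⟨f, a, rfl⟩ := hE.isApp h
    rw [eval]
    exact hE.rootStep_eq (hE.map (fun _ hf => eval_app_of_not_mem_destructors hf) h)
  | @arg f a i t _ ih =>
    simp only [eval]
    congr 2
    funext j
    rcases eq_or_ne j i with rfl | hj
    · simp [ih]
    · simp [hj]

theorem eval_eq_of_steps {t t' : Term} (H : Relation.ReflTransGen (Step E) t t') :
    eval E t = eval E t' := by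
  induction H with
  | refl => rfl
  | tail _ h ih => rw [ih, hE.eval_eq_of_step h]

theorem not_step_of_irreducible {t t' : Term} (H : Irreducible E t) : ¬ Step E t t' := by
  intro h
  induction h with
  | root h =>
    obtain ⟨f, a, rfl⟩ := hE.isApp h
    exact H.2 _ h
  | arg _ ih => exact ih (H.1 _)

theorem irreducible_eval (t : Term) : Irreducible E (eval E t) := by
  induction t with
  | var | name => trivial
  | app f a ih =>
    rw [eval]
    rcases rootStep_cases E (.app f fun i => eval E (a i)) with h | ⟨h, h'⟩
    · exact hE.preserves (fun g hg b => and_iff_left fun r H => hg ⟨b, r, H⟩) h ih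
    · rw [h']
      exact ⟨ih, h⟩

theorem nf_eq_eval : nf E = eval E := by
  funext t
  have H : ∃ W, IsNF E t W :=
    ⟨_, steps_eval t, fun _ => hE.not_step_of_irreducible (hE.irreducible_eval t)⟩
  rw [nf, dif_pos H, hE.eval_eq_of_steps H.choose_spec.1,
    (irreducible_of_not_step H.choose_spec.2).eval_eq]

theorem nf_var (x : Var) : nf E (.var x) = .var x := by
  rw [hE.nf_eq_eval, eval]

theorem nf_name (n : Name) : nf E (.name n) = .name n := by
  rw [hE.nf_eq_eval, eval]

theorem nf_nf (t : Term) : nf E (nf E t) = nf E t := by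
  rw [hE.nf_eq_eval, (hE.irreducible_eval t).eval_eq]

theorem nf_app_of_not_mem_destructors {f : Sym} (hf : f ∉ destructors E)
    (a : Fin f.arity → Term) : nf E (.app f a) = .app f (nf E ∘ a) := by
  rw [hE.nf_eq_eval, eval_app_of_not_mem_destructors hf]

theorem nf_app_of_rule {f : Sym} {a : Fin f.arity → Term} {r : Term}
    (H : E (.app f (nf E ∘ a)) r) : nf E (.app f a) = r := by
  rw [hE.nf_eq_eval] at H ⊢
  rw [eval]
  exact hE.rootStep_eq H

theorem nf_app_cases (f : Sym) (a : Fin f.arity → Term) :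
    E (.app f (nf E ∘ a)) (nf E (.app f a)) ∨ nf E (.app f a) = .app f (nf E ∘ a) := by
  rw [hE.nf_eq_eval, eval]
  exact (rootStep_cases E _).imp_right And.right

theorem rule_of_disjoint {f : Sym} (hf : f ∈ destructors E) {a : Fin f.arity → Term}
    (H : Disjoint (nf E (.app f a)).sig (destructors E)) :
    E (.app f (nf E ∘ a)) (nf E (.app f a)) := by
  refine (hE.nf_app_cases f a).resolve_right fun h => ?_
  rw [h] at H
  exact Set.disjoint_left.1 H (by simp [Term.sig]) hf

theorem rule_of_ne {f : Sym} {a : Fin f.arity → Term} {t : Term} (H : nf E (.app f a) = t)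
    (ht : ∀ a', t ≠ .app f a') : E (.app f (nf E ∘ a)) t :=
  H ▸ (hE.nf_app_cases f a).resolve_right fun h => ht _ (H.symm.trans h)

end IsConstructorTheory

end Rewriting

/-! ### Substitutions by closed terms -/

section Substitution

/-- Terms without variables. -/
def Term.Closed : Term → Prop
  | .var _ => False
  | .name _ => True
  | .app _ a => ∀ i, (a i).Closed

/-- Environments: substitutions that replace variables by closed terms only. They compose without
capturing variables. -/
def Subst.IsEnv (σ : Subst) : Prop := ∀ y, σ y = .var y ∨ (σ y).Closed

/-- `σ`, overridden by `τ` on `s`. -/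
def Subst.override (s : Finset Var) (τ σ : Subst) : Subst := fun y => if y ∈ s then τ y else σ y

variable {σ τ : Subst} {s : Finset Var}

theorem Term.Closed.subst_eq {t : Term} (H : t.Closed) (σ : Subst) : t.subst σ = t := by
  induction t with
  | var x => exact H.elim
  | name n => rfl
  | app f a ih => exact congrArg (Term.app f) (funext fun i => ih i (H i))

theorem Term.subst_subst (t : Term) (σ τ : Subst) :
    (t.subst σ).subst τ = t.subst fun y => (σ y).subst τ := by
  induction t with
  | var x => rfl
  | name n => rfl
  | app f a ih => simp only [Term.subst, ih]

theorem Term.subst_var (t : Term) : t.subst .var = t := by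
  induction t with
  | var x => rfl
  | name n => rfl
  | app f a ih => simp only [Term.subst, ih]

theorem Pat.bv_subst (A : Pat) (σ : Subst) : (A.subst σ).bv = A.bv := by
  induction A with
  | bind x => rfl
  | eq t => rfl
  | tup ps ih => simp only [Pat.subst, Pat.bv, ih]

theorem Pat.subst_subst (A : Pat) (σ τ : Subst) :
    (A.subst σ).subst τ = A.subst fun y => (σ y).subst τ := by
  induction A with
  | bind x => rfl
  | eq t => simp only [Pat.subst, Term.subst_subst]
  | tup ps ih => simp only [Pat.subst, ih]

theorem Pat.subst_var (A : Pat) : A.subst .var = A := by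
  induction A with
  | bind x => rfl
  | eq t => simp only [Pat.subst, Term.subst_var]
  | tup ps ih => simp only [Pat.subst, ih]

theorem Subst.drop_var (s : Finset Var) : Subst.drop .var s = .var :=
  funext fun _ => ite_self _

theorem Proc.subst_var (P : Proc) : P.subst .var = P := by
  induction P <;> simp_all only [Proc.subst, Subst.drop_var, Term.subst_var, Pat.subst_var]

theorem Subst.isEnv_var : Subst.IsEnv .var := fun _ => .inl rfl

theorem Subst.IsEnv.override (hσ : σ.IsEnv) (hτ : ∀ y ∈ s, (τ y).Closed) :
    (Subst.override s τ σ).IsEnv := by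
  intro y
  by_cases h : y ∈ s
  · exact .inr (by simpa only [Subst.override, h, if_true] using hτ y h)
  · simpa only [Subst.override, h, if_false] using hσ y

theorem Subst.IsEnv.update (hσ : σ.IsEnv) (x : Var) {v : Term} (hv : v.Closed) :
    Subst.IsEnv (Function.update σ x v) := by
  intro y
  by_cases h : y = x
  · subst h
    exact .inr (by rwa [Function.update_self])
  · rw [Function.update_of_ne h]
    exact hσ y

theorem Subst.IsEnv.drop (hσ : σ.IsEnv) (s : Finset Var) : (σ.drop s).IsEnv := by
  intro y
  by_cases h : y ∈ s
  · simp only [Subst.drop, h, if_true, true_or]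
  · simpa only [Subst.drop, h, if_false] using hσ y

theorem Subst.IsEnv.drop_comp (hσ : σ.IsEnv) (τ : Subst) (s : Finset Var) :
    (fun y => (σ.drop s y).subst (τ.drop s)) = Subst.drop (fun y => (σ y).subst τ) s := by
  funext y
  by_cases h : y ∈ s
  · simp only [Subst.drop, h, if_true, Term.subst]
  · simp only [Subst.drop, h, if_false]
    rcases hσ y with e | e
    · rw [e]
      exact if_neg h
    · rw [e.subst_eq, e.subst_eq]

theorem Proc.subst_subst (P : Proc) (hσ : σ.IsEnv) (τ : Subst) :
    (P.subst σ).subst τ = P.subst fun y => (σ y).subst τ := by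
  induction P generalizing σ τ with
  | nil => rfl
  | par P Q ih ih' => simp only [Proc.subst, ih hσ, ih' hσ]
  | repl P ih => simp only [Proc.subst, ih hσ]
  | new l x P ih => simp only [Proc.subst, ih (hσ.drop _), hσ.drop_comp]
  | inp U A P ih =>
    simp only [Proc.subst, ih (hσ.drop _), hσ.drop_comp, Term.subst_subst, Pat.bv_subst,
      Pat.subst_subst]
  | out U T P ih => simp only [Proc.subst, ih hσ, Term.subst_subst]
  | ite U V P Q ih ih' => simp only [Proc.subst, ih hσ, ih' hσ, Term.subst_subst]
  | letin x T P ih => simp only [Proc.subst, ih (hσ.drop _), hσ.drop_comp, Term.subst_subst]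

theorem Subst.IsEnv.drop_subst (hσ : σ.IsEnv) (hτ : ∀ y ∉ s, τ y = .var y) :
    (fun y => (σ.drop s y).subst τ) = Subst.override s τ σ := by
  funext y
  by_cases h : y ∈ s
  · simp only [Subst.drop, Subst.override, h, if_true, Term.subst]
  · simp only [Subst.drop, Subst.override, h, if_false]
    rcases hσ y with e | e
    · simp only [e, Term.subst, hτ y h]
    · rw [e.subst_eq]

theorem Proc.subst_drop_subst (P : Proc) (hσ : σ.IsEnv) (hτ : ∀ y ∉ s, τ y = .var y) :
    (P.subst (σ.drop s)).subst τ = P.subst (Subst.override s τ σ) := by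
  rw [P.subst_subst (hσ.drop s), hσ.drop_subst hτ]

theorem Proc.subst_drop_single (P : Proc) (hσ : σ.IsEnv) (x : Var) (v : Term) :
    (P.subst (σ.drop {x})).subst (Subst.single x v) = P.subst (Function.update σ x v) := by
  have hτ : ∀ y ∉ ({x} : Finset Var), Subst.single x v y = .var y := fun y hy =>
    if_neg (mt Finset.mem_singleton.2 hy)
  rw [P.subst_drop_subst hσ hτ]
  congr 1
  funext y
  by_cases h : y = x <;> simp [Subst.override, Subst.single, h]

theorem Pat.toTerm_subst_drop_subst (A : Pat) (hs : A.bv ⊆ s) (hσ : σ.IsEnv)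
    (hτ : ∀ y ∉ s, τ y = .var y) :
    (A.subst (σ.drop s)).toTerm.subst τ = A.toTerm.subst (Subst.override s τ σ) := by
  induction A with
  | bind x =>
    have hx : x ∈ s := hs (Finset.mem_singleton_self x)
    simp only [Pat.subst, Pat.toTerm, Term.subst, Subst.override, hx, if_true]
  | eq t => simp only [Pat.subst, Pat.toTerm, Term.subst_subst, hσ.drop_subst hτ]
  | tup ps ih =>
    have hps (i) : (ps i).bv ⊆ s :=
      (Finset.subset_biUnion_of_mem (fun i => (ps i).bv) (Finset.mem_univ i)).trans hs
    exact congrArg Term.tup (funext fun i => ih i (hps i))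

end Substitution

/-! ### Message typings -/

section Typing

/-- An upper bound on what attackers can learn (`pub`) and on what is sent on which channel
(`msg φ U T`: the term `T` is sent on the channel `U`). Messages that request an operation carry
a fresh name; `φ n` is the value that the request with the name `n` is about, and `datum l σ` is
that value for a name that is created by a restriction with label `l` in the environment `σ`. -/
structure MessageTyping (E : Theory) where
  pub : Term → Prop
  msg : (Name → Term) → Term → Term → Prop
  datum : Label → Subst → Term
  pub_name {n : Name} : n.label = .att → pub (.name n)
  pub_app {f : Sym} {a : Fin f.arity → Term} :
    f ∉ Sym.priv → (∀ i, pub (nf E (a i))) → pub (nf E (.app f a))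
  pub_of_tup {n : ℕ} {ts : Fin n → Term} : pub (.tup ts) → ∀ i, pub (ts i)
  msg_of_pub {φ : Name → Term} {U T : Term} : pub U → pub T → msg φ U T
  pub_of_msg {φ : Name → Term} {U T : Term} : msg φ U T → pub U → pub T
  closed_of_msg {φ : Name → Term} {U T : Term} : msg φ U T → T.Closed

variable {E : Theory} {M : MessageTyping E} {φ : Name → Term}

/-- All messages of the process, run in the environment `σ`, respect the typing, provided that
those it receives do. -/
def MessageTyping.Safe (M : MessageTyping E) (φ : Name → Term) : Proc → Subst → Prop
  | .nil, _ => True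
  | .par P Q, σ => M.Safe φ P σ ∧ M.Safe φ Q σ
  | .repl P, σ => M.Safe φ P σ
  | .new l x P, σ => ∀ n : Name, n.label = l → φ n = M.datum l σ →
      M.Safe φ P (Function.update σ x (.name n))
  | .inp U A P, σ => ∀ τ : Subst, (∀ x ∈ A.bv, nf E (τ x) = τ x) →
      M.msg φ (nf E (U.subst σ)) (nf E (A.toTerm.subst (Subst.override A.bv τ σ))) →
      M.Safe φ P (Subst.override A.bv τ σ)
  | .out U T P, σ => M.msg φ (nf E (U.subst σ)) (nf E (T.subst σ)) ∧ M.Safe φ P σ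
  | .ite U V P Q, σ => (nf E (U.subst σ) = nf E (V.subst σ) → M.Safe φ P σ) ∧
      (nf E (U.subst σ) ≠ nf E (V.subst σ) → M.Safe φ Q σ)
  | .letin x T P, σ => Disjoint (nf E (T.subst σ)).sig (destructors E) →
      (nf E (T.subst σ)).Closed ∧ M.Safe φ P (Function.update σ x (nf E (T.subst σ)))

/-- Instances of processes that are safe, whatever values the names outside `N` have. Leaving
these values open makes it possible to choose the value of a name when the name is created. -/
def MessageTyping.SafeInst (M : MessageTyping E) (N : Set Name) (φ : Name → Term) (R : Proc) :
    Prop :=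
  ∃ (P : Proc) (σ : Subst), σ.IsEnv ∧ P.subst σ = R ∧ ∀ φ', Set.EqOn φ' φ N → M.Safe φ' P σ

/-- The invariant of configurations. -/
def MessageTyping.Inv (M : MessageTyping E) (C : Config) : Prop :=
  (∀ t ∈ C.know, M.pub (nf E t)) ∧ ∃ φ, ∀ P ∈ C.procs, M.SafeInst C.names φ P

namespace MessageTyping

theorem closed_of_pub {T : Term} (H : M.pub T) : T.Closed :=
  M.closed_of_msg (M.msg_of_pub (φ := .name) H H)

theorem pub_of_ded {S : Set Term} (hS : ∀ t ∈ S, M.pub (nf E t)) {T : Term} (H : Ded E S T) :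
    M.pub (nf E T) := by
  induction H with
  | mem hT e => exact e ▸ hS _ hT
  | app hf _ e ih => exact e ▸ M.pub_app hf ih

section SafeInst

variable {N : Set Name} {P Q : Proc} {U V T : Term} {x : Var}

theorem safeInst_of_safe (H : ∀ φ, M.Safe φ P .var) : M.SafeInst N φ P :=
  ⟨P, .var, Subst.isEnv_var, P.subst_var, fun φ' _ => H φ'⟩

theorem SafeInst.union_singleton (H : M.SafeInst N φ P) {n : Name} (hn : n ∉ N) (v : Term) :
    M.SafeInst (N ∪ {n}) (Function.update φ n v) P := by
  obtain ⟨R, σ, hσ, e, h⟩ := H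
  refine ⟨R, σ, hσ, e, fun φ' h' => h φ' fun k hk => ?_⟩
  rw [h' (.inl hk), Function.update_of_ne (ne_of_mem_of_not_mem hk hn)]

theorem SafeInst.par (H : M.SafeInst N φ (.par P Q)) : M.SafeInst N φ P ∧ M.SafeInst N φ Q := by
  obtain ⟨R, σ, hσ, e, h⟩ := H
  cases R <;> simp only [Proc.subst, reduceCtorEq, Proc.par.injEq] at e
  exact ⟨⟨_, σ, hσ, e.1, fun φ' h' => (h φ' h').1⟩, _, σ, hσ, e.2, fun φ' h' => (h φ' h').2⟩

theorem SafeInst.repl (H : M.SafeInst N φ (.repl P)) : M.SafeInst N φ P := by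
  obtain ⟨R, σ, hσ, e, h⟩ := H
  cases R <;> simp only [Proc.subst, reduceCtorEq, Proc.repl.injEq] at e
  exact ⟨_, σ, hσ, e, fun φ' h' => h φ' h'⟩

theorem SafeInst.new {l : Label} (H : M.SafeInst N φ (.new l x P)) :
    ∃ v, ∀ n : Name, n.label = l → n ∉ N →
      M.SafeInst (N ∪ {n}) (Function.update φ n v) (P.subst (Subst.single x (.name n))) := by
  obtain ⟨R, σ, hσ, e, h⟩ := H
  cases R <;> simp only [Proc.subst, reduceCtorEq, Proc.new.injEq] at e
  obtain ⟨el, rfl, rfl⟩ := e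
  obtain rfl := el.symm
  refine ⟨M.datum l σ, fun n hl hn => ⟨_, _, hσ.update _ (v := .name n) trivial,
    (Proc.subst_drop_single _ hσ _ _).symm, fun φ' h' => h φ' (fun k hk => ?_) n hl ?_⟩⟩
  · rw [h' (.inl hk), Function.update_of_ne (ne_of_mem_of_not_mem hk hn)]
  · rw [h' (.inr rfl), Function.update_self]

theorem SafeInst.ite_true (H : M.SafeInst N φ (.ite U V P Q)) (hUV : EqE E U V) :
    M.SafeInst N φ P := by
  obtain ⟨R, σ, hσ, e, h⟩ := H
  cases R <;> simp only [Proc.subst, reduceCtorEq, Proc.ite.injEq] at e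
  obtain ⟨rfl, rfl, e, -⟩ := e
  exact ⟨_, σ, hσ, e, fun φ' h' => (h φ' h').1 hUV⟩

theorem SafeInst.ite_false (H : M.SafeInst N φ (.ite U V P Q)) (hUV : ¬ EqE E U V) :
    M.SafeInst N φ Q := by
  obtain ⟨R, σ, hσ, e, h⟩ := H
  cases R <;> simp only [Proc.subst, reduceCtorEq, Proc.ite.injEq] at e
  obtain ⟨rfl, rfl, -, e⟩ := e
  exact ⟨_, σ, hσ, e, fun φ' h' => (h φ' h').2 hUV⟩

theorem SafeInst.letin (H : M.SafeInst N φ (.letin x T P))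
    (hT : Disjoint (nf E T).sig (destructors E)) :
    M.SafeInst N φ (P.subst (Subst.single x (nf E T))) := by
  obtain ⟨R, σ, hσ, e, h⟩ := H
  cases R <;> simp only [Proc.subst, reduceCtorEq, Proc.letin.injEq] at e
  obtain ⟨rfl, rfl, rfl⟩ := e
  exact ⟨_, _, hσ.update _ (h φ (fun _ _ => rfl) hT).1, (Proc.subst_drop_single _ hσ _ _).symm,
    fun φ' h' => (h φ' h' hT).2⟩

theorem SafeInst.out (H : M.SafeInst N φ (.out U T P)) :
    (∀ φ', Set.EqOn φ' φ N → M.msg φ' (nf E U) (nf E T)) ∧ M.SafeInst N φ P := by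
  obtain ⟨R, σ, hσ, e, h⟩ := H
  cases R <;> simp only [Proc.subst, reduceCtorEq, Proc.out.injEq] at e
  obtain ⟨rfl, rfl, e⟩ := e
  exact ⟨fun φ' h' => (h φ' h').1, _, σ, hσ, e, fun φ' h' => (h φ' h').2⟩

end SafeInst

end MessageTyping

/-- Terms with variables in `X` that attackers can build from the values of their variables. -/
def Term.AttackerIn (X : Set Var) (t : Term) : Prop :=
  t.sig ⊆ Sym.privᶜ ∧ t.names ⊆ {n | n.label = .att} ∧ t.fv ⊆ X

/-- Attacker processes with free variables in `X`. -/
def Proc.AttackerIn (X : Set Var) (P : Proc) : Prop :=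
  P.sig ⊆ Sym.privᶜ ∧ P.names ⊆ {n | n.label = .att} ∧ P.labels ⊆ {.att} ∧ P.fv ⊆ X

namespace Proc.AttackerIn

variable {X : Set Var} {P Q : Proc} {U V T : Term} {x : Var}

theorem par (H : (Proc.par P Q).AttackerIn X) : P.AttackerIn X ∧ Q.AttackerIn X := by
  simp only [AttackerIn, Proc.sig, Proc.names, Proc.labels, Proc.fv, Set.union_subset_iff] at H ⊢
  tauto

theorem new {l : Label} (H : (Proc.new l x P).AttackerIn X) :
    l = .att ∧ P.AttackerIn (insert x X) := by
  simp only [AttackerIn, Proc.sig, Proc.names, Proc.labels, Proc.fv, Set.union_subset_iff,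
    Set.singleton_subset_iff, Set.mem_singleton_iff, Set.sdiff_singleton_subset_iff] at H ⊢
  tauto

theorem inp {A : Pat} (H : (Proc.inp U A P).AttackerIn X) :
    U.AttackerIn X ∧ P.AttackerIn (A.bv ∪ X) := by
  simp only [AttackerIn, Term.AttackerIn, Proc.sig, Proc.names, Proc.labels, Proc.fv,
    Set.union_subset_iff, Set.sdiff_subset_iff] at H ⊢
  tauto

theorem out (H : (Proc.out U T P).AttackerIn X) :
    U.AttackerIn X ∧ T.AttackerIn X ∧ P.AttackerIn X := by
  simp only [AttackerIn, Term.AttackerIn, Proc.sig, Proc.names, Proc.labels, Proc.fv,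
    Set.union_subset_iff] at H ⊢
  tauto

theorem ite (H : (Proc.ite U V P Q).AttackerIn X) : P.AttackerIn X ∧ Q.AttackerIn X := by
  simp only [AttackerIn, Proc.sig, Proc.names, Proc.labels, Proc.fv, Set.union_subset_iff] at H ⊢
  tauto

theorem letin (H : (Proc.letin x T P).AttackerIn X) :
    T.AttackerIn X ∧ P.AttackerIn (insert x X) := by
  simp only [AttackerIn, Term.AttackerIn, Proc.sig, Proc.names, Proc.labels, Proc.fv,
    Set.union_subset_iff, Set.sdiff_singleton_subset_iff] at H ⊢
  tauto

end Proc.AttackerIn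

theorem Attacker.attackerIn {Q : Proc} (H : Attacker Q) : Q.AttackerIn ∅ := by
  obtain ⟨hfv, hsig, hnames, hlabels⟩ := H
  exact ⟨Set.disjoint_left.1 (Set.disjoint_iff_inter_eq_empty.2 hsig), hnames, hlabels, hfv.le⟩

theorem MessageTyping.pub_nf_subst (hE : IsConstructorTheory E) {X : Set Var} {t : Term}
    (H : t.AttackerIn X) {σ : Subst} (hσ : ∀ x ∈ X, M.pub (nf E (σ x))) :
    M.pub (nf E (t.subst σ)) := by
  induction t with
  | var x => exact hσ x (H.2.2 rfl)
  | name n =>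
    rw [Term.subst, hE.nf_name]
    exact M.pub_name (H.2.1 rfl)
  | app f a ih =>
    simp only [Term.AttackerIn, Term.sig, Term.names, Term.fv, Set.union_subset_iff,
      Set.iUnion_subset_iff, Set.singleton_subset_iff] at H ih
    exact M.pub_app H.1.1 fun i => ih i ⟨H.1.2 i, H.2.1 i, H.2.2 i⟩

theorem MessageTyping.pub_nf_update {X : Set Var} {σ : Subst} (hσ : ∀ y ∈ X, M.pub (nf E (σ y)))
    (x : Var) {v : Term} (hv : M.pub (nf E v)) :
    ∀ y ∈ insert x X, M.pub (nf E (Function.update σ x v y)) := by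
  intro y hy
  by_cases h : y = x
  · subst h
    rwa [Function.update_self]
  · rw [Function.update_of_ne h]
    exact hσ y (hy.resolve_left h)

variable (hE : IsConstructorTheory E) (htup : ∀ n, Sym.tup n ∉ destructors E)
include hE htup

theorem Pat.forall_bv {X : Term → Prop}
    (hX : ∀ {n : ℕ} {ts : Fin n → Term}, X (.tup ts) → ∀ i, X (ts i)) (A : Pat) (τ : Subst)
    (hτ : ∀ x ∈ A.bv, nf E (τ x) = τ x) (H : X (nf E (A.toTerm.subst τ))) :
    ∀ x ∈ A.bv, X (τ x) := by
  induction A with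
  | bind x =>
    simp only [Pat.bv, Finset.mem_singleton, forall_eq, Pat.toTerm, Term.subst] at hτ H ⊢
    rwa [← hτ]
  | eq t => exact fun x hx => absurd hx (Finset.notMem_empty x)
  | tup ps ih =>
    intro x hx
    simp only [Pat.bv, Finset.mem_biUnion, Finset.mem_univ, true_and] at hx hτ
    obtain ⟨i, hx⟩ := hx
    rw [Pat.toTerm, Term.subst, hE.nf_app_of_not_mem_destructors (htup _)] at H
    exact ih i (fun x hx => hτ x ⟨i, hx⟩) (hX H i) x hx

namespace MessageTyping

theorem SafeInst.inp {N : Set Name} {U : Term} {A : Pat} {P : Proc}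
    (H : M.SafeInst N φ (.inp U A P)) {τ : Subst} (hτ : ∀ x ∈ A.bv, nf E (τ x) = τ x)
    (hτ' : ∀ x ∉ A.bv, τ x = .var x)
    (hmsg : ∀ φ', Set.EqOn φ' φ N → M.msg φ' (nf E U) (nf E (A.toTerm.subst τ))) :
    M.SafeInst N φ (P.subst τ) := by
  have hclosed : ∀ x ∈ A.bv, (τ x).Closed :=
    Pat.forall_bv hE htup (fun h => h) A τ hτ (M.closed_of_msg (hmsg φ fun _ _ => rfl))
  obtain ⟨R, σ, hσ, e, h⟩ := H
  cases R <;> simp only [Proc.subst, reduceCtorEq, Proc.inp.injEq] at e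
  obtain ⟨rfl, rfl, rfl⟩ := e
  rw [Pat.bv_subst] at hτ hτ' hclosed
  refine ⟨_, _, hσ.override hclosed, (Proc.subst_drop_subst _ hσ hτ').symm,
    fun φ' h' => h φ' h' τ hτ ?_⟩
  rw [← Pat.toTerm_subst_drop_subst _ subset_rfl hσ hτ']
  exact hmsg φ' h'

theorem Inv.red {C C' : Config} (H : M.Inv C) (h : Red E C C') : M.Inv C' := by
  obtain ⟨hM, φ, H⟩ := H
  cases h with
  | nil => exact ⟨hM, φ, (Multiset.forall_mem_cons.1 H).2⟩
  | new hl hn =>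
    obtain ⟨hP, H⟩ := Multiset.forall_mem_cons.1 H
    obtain ⟨v, hv⟩ := hP.new
    exact ⟨hM, _, Multiset.forall_mem_cons.2
      ⟨hv _ hl hn, fun R hR => (H R hR).union_singleton hn v⟩⟩
  | comm hU hτ hτ' hT =>
    simp only [Multiset.forall_mem_cons] at H
    obtain ⟨hP, hQ, H⟩ := H
    refine ⟨?_, φ, ?_⟩
    · rintro t (ht | ⟨rfl, ht⟩)
      · exact hM t ht
      · exact M.pub_of_msg (hP.out.1 φ fun _ _ => rfl) (pub_of_ded hM ht)
    · simp only [Multiset.forall_mem_cons]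
      exact ⟨hP.out.2, hQ.inp hE htup hτ hτ' fun φ' h' => hU ▸ hT ▸ hP.out.1 φ' h', H⟩
  | _ =>
    refine ⟨hM, φ, ?_⟩
    simp only [Multiset.forall_mem_cons] at H ⊢
    first
    | exact ⟨H.1.repl, H⟩
    | exact ⟨H.1.par.1, H.1.par.2, H.2⟩
    | exact ⟨H.1.ite_true ‹_›, H.2⟩
    | exact ⟨H.1.ite_false ‹_›, H.2⟩
    | exact ⟨H.1.letin ‹_›, H.2⟩

theorem safe_of_attackerIn {X : Set Var} {P : Proc} (H : P.AttackerIn X) {σ : Subst}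
    (hσ : ∀ x ∈ X, M.pub (nf E (σ x))) : M.Safe φ P σ := by
  induction P generalizing X σ with
  | nil => trivial
  | par P Q ihP ihQ => exact ⟨ihP H.par.1 hσ, ihQ H.par.2 hσ⟩
  | repl P ih => exact ih H hσ
  | new l x P ih =>
    intro n hl _
    refine ih H.new.2 (pub_nf_update hσ x ?_)
    rw [hE.nf_name]
    exact M.pub_name (hl.trans H.new.1)
  | inp U A P ih =>
    intro τ hτ hmsg
    have hbv := Pat.forall_bv hE htup M.pub_of_tup A (Subst.override A.bv τ σ)
      (fun x hx => by simpa only [Subst.override, hx, if_true] using hτ x hx)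
      (M.pub_of_msg hmsg (pub_nf_subst hE H.inp.1 hσ))
    refine ih H.inp.2 fun y hy => ?_
    by_cases h : y ∈ A.bv
    · have hy := hbv y h
      simp only [Subst.override, h, if_true] at hy ⊢
      rwa [hτ y h]
    · simpa only [Subst.override, h, if_false] using hσ y (hy.resolve_left h)
  | out U T P ih =>
    exact ⟨M.msg_of_pub (pub_nf_subst hE H.out.1 hσ) (pub_nf_subst hE H.out.2.1 hσ),
      ih H.out.2.2 hσ⟩
  | ite U V P Q ihP ihQ => exact ⟨fun _ => ihP H.ite.1 hσ, fun _ => ihQ H.ite.2 hσ⟩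
  | letin x T P ih =>
    have hT := pub_nf_subst hE H.letin.1 hσ
    exact fun _ => ⟨closed_of_pub hT, ih H.letin.2 (pub_nf_update hσ x (by rwa [hE.nf_nf]))⟩

theorem pub_of_att {P : Proc} (hP : ∀ φ, M.Safe φ P .var) {T : Term} (H : Att E P T) :
    M.pub (nf E T) := by
  obtain ⟨Q, hQ, C, hC, hT⟩ := H
  suffices hinv : M.Inv C from pub_of_ded hinv.1 hT
  clear hT
  induction hC with
  | refl =>
    refine ⟨fun t ht => ht.elim, .name, fun R hR => ?_⟩
    rw [Multiset.mem_singleton.1 hR]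
    exact safeInst_of_safe fun φ =>
      ⟨hP φ, safe_of_attackerIn hE htup hQ.attackerIn fun x hx => hx.elim⟩
  | tail _ h ih => exact ih.red hE htup h

end MessageTyping

end Typing

/-! ### The theories of the platform are constructor theories -/

section Platform

/-- The theory of the platform without bound (`none`) or with bound `b` on the extensions
(`some b`). -/
def platformTheory : Option ℕ → Theory
  | none => Edrt
  | some b => Edrtb b

/-- The symbols at the root of the rules, including those for bounded extensions. -/
def Sym.isDestructor : Sym → Bool
  | .proj _ _ | .sdec | .unsealData | .get_entry | .pcr | .int | .cacheR | .stm | .smi | .init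
  | .pp | .lock | .reset | .extend | .set_pcr | .set_int | .cacheW | .flush_stm | .flush_smi
  | .set_init | .set_pp | .set_lock | .is_small | .is_big => true
  | _ => false

variable {β : Option ℕ} {l r : Term}

theorem platformTheory_iff : platformTheory β l r ↔
    Etup l r ∨ Edata l r ∨ Eprog l r ∨ Estate l r ∨ ∃ b ∈ β, Ebound b l r := by
  cases β <;> simp [platformTheory, Edrt, Edrtb, or_assoc]

theorem exists_destructor_of_platformTheory (H : platformTheory β l r) :
    ∃ f a, f.isDestructor ∧ l = .app f a := by
  rcases platformTheory_iff.1 H with H | H | H | H | ⟨b, -, H⟩ <;> cases H <;>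
    exact ⟨_, _, rfl, rfl⟩

theorem not_mem_destructors {f : Sym} (hf : f.isDestructor = false) :
    f ∉ destructors (platformTheory β) := by
  rintro ⟨a, r, H⟩
  obtain ⟨g, b, hg, h⟩ := exists_destructor_of_platformTheory H
  cases h
  simp [hf] at hg

@[simp]
theorem comp_vecEmpty {α γ : Type*} (φ : α → γ) (v : Fin 0 → α) : φ ∘ v = ![] :=
  Subsingleton.elim _ _

@[simp]
theorem comp_vecCons {α γ : Type*} (φ : α → γ) (x : α) {n : ℕ} (v : Fin n → α) :
    φ ∘ Matrix.vecCons x v = Matrix.vecCons (φ x) (φ ∘ v) :=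
  Fin.comp_cons φ x v

section Map

variable {φ : Term → Term}
  (hφ : ∀ f : Sym, f.isDestructor = false → ∀ a, φ (.app f a) = .app f (φ ∘ a))

include hφ

theorem map_chain (v : Term) (vs : List Term) :
    φ (Term.chain v vs) = Term.chain (φ v) (vs.map φ) := by
  induction vs generalizing v with
  | nil => rfl
  | cons w vs ih =>
    exact (ih _).trans (by simp [Term.chain, hφ .h rfl, hφ (.tup 2) rfl])

theorem Estate.map {f : Sym} {a : Fin f.arity → Term} (H : Estate (.app f a) r) :
    Estate (.app f (φ ∘ a)) (φ r) := by
  cases H <;> simp only [comp_vecCons, comp_vecEmpty, Term.state, hφ .state rfl, hφ .tpm rfl,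
    hφ .cpu rfl, hφ .smram rfl, hφ .drt rfl, hφ .h rfl, hφ (.tup 2) rfl, hφ .prog rfl,
    hφ .tpm_acc rfl, hφ .cpu_acc rfl, hφ .ps rfl, hφ .pd rfl, hφ .tt rfl, hφ .ff rfl]
  case pcr => exact .pcr ..
  case int => exact .int ..
  case cacheR => exact .cacheR ..
  case stm => exact .stm ..
  case smi => exact .smi ..
  case init => exact .init ..
  case pp => exact .pp ..
  case lock => exact .lock ..
  case reset_ps => exact .reset_ps ..
  case reset_pd => exact .reset_pd ..
  case extend => exact .extend ..
  case set_pcr => exact .set_pcr ..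
  case set_int_cpu => exact .set_int_cpu ..
  case set_int_pp => exact .set_int_pp ..
  case cacheW => exact .cacheW ..
  case flush_stm => exact .flush_stm ..
  case flush_smi => exact .flush_smi ..
  case set_init => exact .set_init ..
  case set_pp_cpu => exact .set_pp_cpu ..
  case set_pp_init => exact .set_pp_init ..
  case set_pp_smi => exact .set_pp_smi ..
  case set_lock_cpu => exact .set_lock_cpu ..
  case set_lock_pp => exact .set_lock_pp ..
  case set_lock_smi => exact .set_lock_smi ..

theorem platformTheory_map {f : Sym} {a : Fin f.arity → Term} (H : platformTheory β (.app f a) r) :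
    platformTheory β (.app f (φ ∘ a)) (φ r) := by
  rw [platformTheory_iff] at H ⊢
  rcases H with H | H | H | H | ⟨b, hb, H⟩
  · cases H with
    | proj i ts => simpa [hφ (.tup _) rfl] using .inl (.proj i (φ ∘ ts))
  · cases H with
    | sdec _ k => simpa [hφ .senc rfl] using .inr (.inl (.sdec (φ r) (φ k)))
    | unsealData _ p => simpa [hφ .sealData rfl] using .inr (.inl (.unsealData (φ r) (φ p)))
  · cases H with
    | get_entry _ => simpa [hφ .prog rfl] using .inr (.inr (.inl (.get_entry (φ r))))
  · exact .inr (.inr (.inr (.inl (H.map hφ))))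
  · refine .inr (.inr (.inr (.inr ⟨b, hb, ?_⟩)))
    cases H with
    | small_ps vs h =>
      simpa [map_chain hφ, hφ .ps rfl, hφ .tt rfl] using Ebound.small_ps (vs.map φ) (by simpa)
    | small_pd vs h =>
      simpa [map_chain hφ, hφ .pd rfl, hφ .tt rfl] using Ebound.small_pd (vs.map φ) (by simpa)
    | big v₀ vs h =>
      simpa [map_chain hφ, hφ .tt rfl] using Ebound.big (φ v₀) (vs.map φ) (by simpa)

end Map

section Preserves

variable {X : Term → Prop}
  (hX : ∀ f : Sym, f.isDestructor = false → ∀ a, X (.app f a) ↔ ∀ i, X (a i))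

include hX

theorem Estate.preserves {f : Sym} {a : Fin f.arity → Term} (H : Estate (.app f a) r)
    (ha : ∀ i, X (a i)) : X r := by
  cases H <;>
    simp_all [Fin.forall_fin_succ, hX .state rfl, hX .tpm rfl, hX .cpu rfl, hX .smram rfl,
      hX .drt rfl, hX .h rfl, hX (.tup 2) rfl, hX .prog rfl, hX .tt rfl, hX .ff rfl]

theorem platformTheory_preserves {f : Sym} {a : Fin f.arity → Term}
    (H : platformTheory β (.app f a) r) (ha : ∀ i, X (a i)) : X r := by
  rcases platformTheory_iff.1 H with H | H | H | H | ⟨b, -, H⟩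
  · cases H with
    | proj i ts => exact (hX (.tup _) rfl _).1 (ha 0) i
  · cases H with
    | sdec v k => exact (hX .senc rfl _).1 (ha 0) 0
    | unsealData v p => exact (hX .sealData rfl _).1 (ha 0) 0
  · cases H with
    | get_entry x => exact (hX .prog rfl _).1 (ha 0) 0
  · exact H.preserves hX ha
  · cases H <;> exact (hX .tt rfl _).2 nofun

end Preserves

open Term in
/-- The token `t` authorizes a write to the component `pp` or `lock` of a state with processor `y`
and memory `z`. The program `x` is the one that may perform the write: `init` may write `pp`, and
`pp` may write `lock`. -/
def Authorizes (t x y z : Term) : Prop :=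
  t = cpu_acc ∨ x = prog t ∨
    ∃ k z₁ z₂, y = cpu tt k ∧ z = smram (prog z₁) (prog z₂) ∧ t = tup ![z₁, z₂]

open Term in
/-- The rule instances with left-hand side `f(a)` and right-hand side `r`, by cases on `f`. The
rules for the same `f` are merged, and `a` enters only through equations for its components, so that
it can be an arbitrary function. -/
def Redex (β : Option ℕ) : (f : Sym) → (Fin f.arity → Term) → Term → Prop
  | .proj n i, a, r => ∃ ts : Fin n → Term, a 0 = tup ts ∧ r = ts i
  | .sdec, a, r => ∃ k, a 0 = senc r k ∧ a 1 = k
  | .unsealData, a, r => ∃ k, a 0 = sealData r k ∧ a 1 = k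
  | .get_entry, a, r => a 0 = prog r
  | .pcr, a, r => ∃ x₁ x₂ x₃, a 0 = state (tpm r) x₁ x₂ x₃
  | .int, a, r => ∃ x₁ y x₂ x₃, a 0 = state x₁ (cpu r y) x₂ x₃
  | .cacheR, a, r => ∃ x₁ y x₂ x₃, a 0 = state x₁ (cpu y r) x₂ x₃
  | .stm, a, r => ∃ x₁ x₂ y x₃, a 0 = state x₁ x₂ (smram r y) x₃
  | .smi, a, r => ∃ x₁ x₂ y x₃, a 0 = state x₁ x₂ (smram y r) x₃
  | .init, a, r => ∃ x₁ x₂ x₃ y z, a 0 = state x₁ x₂ x₃ (drt r y z)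
  | .pp, a, r => ∃ x₁ x₂ x₃ y z, a 0 = state x₁ x₂ x₃ (drt y r z)
  | .lock, a, r => ∃ x₁ x₂ x₃ y z, a 0 = state x₁ x₂ x₃ (drt y z r)
  | .reset, a, r => ∃ y x₁ x₂ x₃ v, a 0 = state (tpm y) x₁ x₂ x₃ ∧ a 1 = tpm_acc ∧ a 2 = v ∧
      (v = ps ∨ v = pd) ∧ r = state (tpm v) x₁ x₂ x₃
  | .extend, a, r => ∃ y x₁ x₂ x₃ v, a 0 = state (tpm y) x₁ x₂ x₃ ∧ a 1 = tpm_acc ∧ a 2 = v ∧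
      r = state (tpm (h (tup ![y, v]))) x₁ x₂ x₃
  | .set_pcr, a, r => ∃ y x₁ x₂ x₃ v, a 0 = state (tpm y) x₁ x₂ x₃ ∧ a 1 = tpm_acc ∧ a 2 = v ∧
      r = state (tpm v) x₁ x₂ x₃
  | .set_int, a, r => ∃ x₁ y z x₂ x₃ t v, a 0 = state x₁ (cpu y z) x₂ x₃ ∧ a 1 = t ∧ a 2 = v ∧
      (t = cpu_acc ∨ ∃ w, x₃ = drt w (prog t) tt) ∧ r = state x₁ (cpu v z) x₂ x₃
  | .cacheW, a, r => ∃ x₁ y z x₂ x₃ v, a 0 = state x₁ (cpu y z) x₂ x₃ ∧ a 1 = v ∧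
      r = state x₁ (cpu y v) x₂ x₃
  | .flush_stm, a, r => ∃ x₁ y v z₁ z₂ w₁ w₂,
      a 0 = state x₁ (cpu y v) (smram z₁ z₂) (drt w₁ w₂ ff) ∧
      r = state x₁ (cpu y v) (smram v z₂) (drt w₁ w₂ ff)
  | .flush_smi, a, r => ∃ x₁ y v z₁ z₂ x₂,
      a 0 = state x₁ (cpu y v) (smram z₁ z₂) x₂ ∧ r = state x₁ (cpu y v) (smram z₁ v) x₂
  | .set_init, a, r => ∃ x₁ x₂ x₃ y₁ y₂ y₃ v, a 0 = state x₁ x₂ x₃ (drt y₁ y₂ y₃) ∧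
      a 1 = cpu_acc ∧ a 2 = v ∧ r = state x₁ x₂ x₃ (drt v y₂ y₃)
  | .set_pp, a, r => ∃ x₁ x₂ x₃ y₁ y₂ y₃ t v, a 0 = state x₁ x₂ x₃ (drt y₁ y₂ y₃) ∧
      a 1 = t ∧ a 2 = v ∧ Authorizes t y₁ x₂ x₃ ∧ r = state x₁ x₂ x₃ (drt y₁ v y₃)
  | .set_lock, a, r => ∃ x₁ x₂ x₃ y₁ y₂ y₃ t v, a 0 = state x₁ x₂ x₃ (drt y₁ y₂ y₃) ∧
      a 1 = t ∧ a 2 = v ∧ Authorizes t y₂ x₂ x₃ ∧ r = state x₁ x₂ x₃ (drt y₁ y₂ v)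
  | .is_small, a, r => ∃ b ∈ β, ∃ v₀ vs, (v₀ = ps ∨ v₀ = pd) ∧ vs.length < b ∧
      a 0 = chain v₀ vs ∧ r = tt
  | .is_big, a, r => ∃ b ∈ β, ∃ v₀ vs, vs.length = b + 1 ∧ a 0 = chain v₀ vs ∧ r = tt
  | _, _, _ => False

theorem Estate.redex {f : Sym} {a : Fin f.arity → Term} (H : Estate (.app f a) r) :
    Redex β f a r := by
  cases H
  case pcr => exact ⟨_, _, _, rfl⟩
  case int => exact ⟨_, _, _, _, rfl⟩
  case cacheR => exact ⟨_, _, _, _, rfl⟩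
  case stm => exact ⟨_, _, _, _, rfl⟩
  case smi => exact ⟨_, _, _, _, rfl⟩
  case init => exact ⟨_, _, _, _, _, rfl⟩
  case pp => exact ⟨_, _, _, _, _, rfl⟩
  case lock => exact ⟨_, _, _, _, _, rfl⟩
  case reset_ps => exact ⟨_, _, _, _, _, rfl, rfl, rfl, .inl rfl, rfl⟩
  case reset_pd => exact ⟨_, _, _, _, _, rfl, rfl, rfl, .inr rfl, rfl⟩
  case extend => exact ⟨_, _, _, _, _, rfl, rfl, rfl, rfl⟩
  case set_pcr => exact ⟨_, _, _, _, _, rfl, rfl, rfl, rfl⟩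
  case set_int_cpu => exact ⟨_, _, _, _, _, _, _, rfl, rfl, rfl, .inl rfl, rfl⟩
  case set_int_pp => exact ⟨_, _, _, _, _, _, _, rfl, rfl, rfl, .inr ⟨_, rfl⟩, rfl⟩
  case cacheW => exact ⟨_, _, _, _, _, _, rfl, rfl, rfl⟩
  case flush_stm => exact ⟨_, _, _, _, _, _, _, rfl, rfl⟩
  case flush_smi => exact ⟨_, _, _, _, _, _, rfl, rfl⟩
  case set_init => exact ⟨_, _, _, _, _, _, _, rfl, rfl, rfl, rfl⟩
  case set_pp_cpu => exact ⟨_, _, _, _, _, _, _, _, rfl, rfl, rfl, .inl rfl, rfl⟩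
  case set_pp_init => exact ⟨_, _, _, _, _, _, _, _, rfl, rfl, rfl, .inr (.inl rfl), rfl⟩
  case set_pp_smi =>
    exact ⟨_, _, _, _, _, _, _, _, rfl, rfl, rfl, .inr (.inr ⟨_, _, _, rfl, rfl, rfl⟩), rfl⟩
  case set_lock_cpu => exact ⟨_, _, _, _, _, _, _, _, rfl, rfl, rfl, .inl rfl, rfl⟩
  case set_lock_pp => exact ⟨_, _, _, _, _, _, _, _, rfl, rfl, rfl, .inr (.inl rfl), rfl⟩
  case set_lock_smi =>
    exact ⟨_, _, _, _, _, _, _, _, rfl, rfl, rfl, .inr (.inr ⟨_, _, _, rfl, rfl, rfl⟩), rfl⟩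

theorem platformTheory.redex {f : Sym} {a : Fin f.arity → Term}
    (H : platformTheory β (.app f a) r) : Redex β f a r := by
  rcases platformTheory_iff.1 H with H | H | H | H | ⟨b, hb, H⟩
  · cases H
    exact ⟨_, rfl, rfl⟩
  · cases H <;> exact ⟨_, rfl, rfl⟩
  · cases H
    exact rfl
  · exact H.redex
  · cases H with
    | small_ps vs h => exact ⟨b, hb, _, vs, .inl rfl, h, rfl, rfl⟩
    | small_pd vs h => exact ⟨b, hb, _, vs, .inr rfl, h, rfl, rfl⟩
    | big v₀ vs h => exact ⟨b, hb, _, vs, h, rfl, rfl⟩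

theorem Redex.unique {f : Sym} {a : Fin f.arity → Term} {r r' : Term}
    (H : Redex β f a r) (H' : Redex β f a r') : r = r' := by
  cases f <;> first | exact H.elim | simp only [Redex] at H H'
  case proj n i =>
    obtain ⟨ts, h, rfl⟩ := H
    obtain ⟨ts', h', rfl⟩ := H'
    simp_all
  all_goals grind [Matrix.vecCons_inj]

theorem isConstructorTheory_platformTheory (β : Option ℕ) :
    IsConstructorTheory (platformTheory β) where
  isApp H := (exists_destructor_of_platformTheory H).imp fun _ ⟨a, _, h⟩ => ⟨a, h⟩
  unique H H' := by
    obtain ⟨f, a, -, rfl⟩ := exists_destructor_of_platformTheory H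
    exact H.redex.unique H'.redex
  map hφ _ _ _ H := platformTheory_map (fun f hf => hφ f (not_mem_destructors hf)) H
  preserves hX _ _ _ H := platformTheory_preserves (fun f hf => hX f (not_mem_destructors hf)) H

end Platform

/-! ### The knowledge of the attacker -/

section Knowledge

open Term

/-- The value of the register after the launch of the loader `a` with the handler `m`. -/
abbrev launchReg (a m : Term) : Term := h (tup ![pd, tup ![h a, h m]])

theorem hchain_eq :
    hchain = h (tup ![launchReg (prog Tinit) (prog Tstm), h (prog Tpp)]) := rfl

/-- The invariant of the states that are available to the attacker: no extension by the attacker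
leads from their register `p` to `hchain`, and if `p` is `hchain`, then the trusted programs are
loaded and locked. -/
structure SafeState (p m a q l : Term) : Prop where
  ne_pd : p ≠ pd
  ne_launch : p ≠ launchReg (prog Tinit) (prog Tstm)
  trusted : p = hchain → m = prog Tstm ∧ a = prog Tinit ∧ q = prog Tpp ∧ l = tt

/-- An upper bound on the knowledge of the attacker. -/
inductive Public : Term → Prop
  | name {n : Name} : n.label ≠ .kpp → Public (.name n)
  | app {f : Sym} {a : Fin f.arity → Term} :
      f ∉ Sym.priv → (∀ i, Public (a i)) → Public (.app f a)
  | senc {x : Term} {j : ℕ} : Public x → Public (senc x (.name ⟨.kpp, j⟩))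
  | sealData {j : ℕ} : Public (sealData (.name ⟨.kpp, j⟩) hchain)
  | prog {j : ℕ} : Public (prog (entry j))
  | tpm_ch {e : Term} : Public e → Public (tpm_ch (prog e))
  | state {p i k m s a q l : Term} : Public p → Public i → Public k → Public m → Public s →
      Public a → Public q → Public l → SafeState p m a q l →
      Public (state (tpm p) (cpu i k) (smram m s) (drt a q l))

/-- The inversion principle of `Public`, by cases on the root symbol. -/
def PublicCases : Term → Prop
  | .var _ => False
  | .name n => n.label ≠ .kpp
  | .app .senc a => Public (a 0) ∧ (Public (a 1) ∨ ∃ j, a 1 = .name ⟨.kpp, j⟩)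
  | .app .sealData a =>
      Public (a 1) ∧ (Public (a 0) ∨ (∃ j, a 0 = .name ⟨.kpp, j⟩) ∧ a 1 = hchain)
  | .app .prog a => Public (a 0) ∨ ∃ j, a 0 = entry j
  | .app .tpm_ch a => ∃ e, a 0 = prog e ∧ Public e
  | .app .state x => ∃ p i k m s a q l, x = ![tpm p, cpu i k, smram m s, drt a q l] ∧
      Public p ∧ Public i ∧ Public k ∧ Public m ∧ Public s ∧ Public a ∧ Public q ∧ Public l ∧
      SafeState p m a q l
  | .app f a => f ∉ Sym.priv ∧ ∀ i, Public (a i)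

theorem Public.const {f : Sym} {a : Fin f.arity → Term} (h : f.arity = 0) (hf : f ∉ Sym.priv) :
    Public (.app f a) :=
  .app hf fun i => (Fin.cast h i).elim0

theorem Public.h {x : Term} (hx : Public x) : Public (h x) :=
  .app (by simp [Sym.priv]) (by simpa [Fin.forall_fin_succ] using hx)

theorem Public.tup {n : ℕ} {x : Fin n → Term} (hx : ∀ i, Public (x i)) : Public (tup x) :=
  .app (by simp [Sym.priv]) hx

theorem Public.pair {x y : Term} (hx : Public x) (hy : Public y) : Public (Term.tup ![x, y]) :=
  .tup (by simpa [Fin.forall_fin_succ] using ⟨hx, hy⟩)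

theorem Public.launchReg {a m : Term} (ha : Public a) (hm : Public m) :
    Public (launchReg a m) :=
  .h (.pair (.const rfl (by simp [Sym.priv])) (.pair ha.h hm.h))

theorem public_hchain : Public hchain :=
  .h (.pair (.launchReg .prog .prog) (.h .prog))

theorem Public.inv {t : Term} (H : Public t) : PublicCases t := by
  cases H with
  | @app f a hf ha =>
    cases f
    case senc => exact ⟨ha 0, .inl (ha 1)⟩
    case sealData => exact ⟨ha 1, .inl (ha 0)⟩
    case prog => exact .inl (ha 0)
    case tpm_ch | state => simp [Sym.priv] at hf
    all_goals exact ⟨hf, ha⟩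
  | name h => exact h
  | senc h => exact ⟨h, .inr ⟨_, rfl⟩⟩
  | sealData => exact ⟨public_hchain, .inr ⟨⟨_, rfl⟩, rfl⟩⟩
  | prog => exact .inr ⟨_, rfl⟩
  | tpm_ch h => exact ⟨_, rfl, h⟩
  | state hp hi hk hm hs ha hq hl H =>
    exact ⟨_, _, _, _, _, _, _, _, rfl, hp, hi, hk, hm, hs, ha, hq, hl, H⟩

@[simp]
theorem not_public_tpm_acc : ¬ Public tpm_acc := fun H => H.inv.1 (by simp [Sym.priv])

@[simp]
theorem not_public_cpu_acc : ¬ Public cpu_acc := fun H => H.inv.1 (by simp [Sym.priv])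

@[simp]
theorem not_public_cpu_tpm : ¬ Public cpu_tpm := fun H => H.inv.1 (by simp [Sym.priv])

@[simp]
theorem not_public_entry (j : ℕ) : ¬ Public (entry j) := fun H => H.inv.1 (by simp [Sym.priv])

@[simp]
theorem not_public_name_kpp (j : ℕ) : ¬ Public (.name ⟨.kpp, j⟩) := fun H => H.inv rfl

@[simp]
theorem public_tup {n : ℕ} {x : Fin n → Term} : Public (tup x) ↔ ∀ i, Public (x i) :=
  ⟨fun H => H.inv.2, .tup⟩

theorem public_prog {x : Term} : Public (prog x) ↔ Public x ∨ ∃ j, x = entry j := by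
  refine ⟨fun H => H.inv, ?_⟩
  rintro (hx | ⟨j, rfl⟩)
  · exact .app (by simp [Sym.priv]) (by simpa [Fin.forall_fin_succ] using hx)
  · exact .prog

theorem public_tpm_ch {x : Term} : Public (tpm_ch x) ↔ ∃ e, x = prog e ∧ Public e := by
  refine ⟨fun H => H.inv, ?_⟩
  rintro ⟨e, rfl, he⟩
  exact .tpm_ch he

@[simp]
theorem not_public_tpm_ch_entry (j : ℕ) : ¬ Public (tpm_ch (prog (entry j))) := by
  simp [public_tpm_ch]

theorem Public.state_inv {x y z w : Term} (H : Public (Term.state x y z w)) :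
    ∃ p i k m s a q l, (x = tpm p ∧ y = cpu i k ∧ z = smram m s ∧ w = drt a q l) ∧
      Public p ∧ Public i ∧ Public k ∧ Public m ∧ Public s ∧ Public a ∧ Public q ∧ Public l ∧
      SafeState p m a q l := by
  obtain ⟨p, i, k, m, s, a, q, l, e, H'⟩ := H.inv
  exact ⟨p, i, k, m, s, a, q, l, by simpa using e, H'⟩

theorem public_state {p i k m s a q l : Term} :
    Public (state (tpm p) (cpu i k) (smram m s) (drt a q l)) ↔
      Public p ∧ Public i ∧ Public k ∧ Public m ∧ Public s ∧ Public a ∧ Public q ∧ Public l ∧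
      SafeState p m a q l := by
  constructor
  · intro H
    obtain ⟨p, i, k, m, s, a, q, l, e, H'⟩ := H.state_inv
    simp only [Term.app.injEq, heq_eq_eq, Matrix.vecCons_inj, true_and, and_true] at e
    obtain ⟨rfl, ⟨rfl, rfl⟩, ⟨rfl, rfl⟩, rfl, rfl, rfl⟩ := e
    exact H'
  · rintro ⟨hp, hi, hk, hm, hs, ha, hq, hl, H⟩
    exact .state hp hi hk hm hs ha hq hl H

theorem Public.closed {t : Term} (H : Public t) : t.Closed := by
  induction H with
  | name => trivial
  | app _ _ ih => exact ih
  | senc _ ih => simpa [Term.Closed, Fin.forall_fin_succ] using ih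
  | sealData => simp [Term.Closed, Fin.forall_fin_succ, Term.chain]
  | prog => simp [Term.Closed]
  | tpm_ch _ ih => simpa [Term.Closed] using ih
  | state => simp_all [Term.Closed, Fin.forall_fin_succ]

theorem Public.not_authorizes {t y s : Term} (ht : Public t) (j k : ℕ) :
    ¬ Authorizes t (Term.prog (entry j)) y (smram (Term.prog (entry k)) s) := by
  rintro (rfl | e | ⟨_, _, _, -, e, rfl⟩)
  · simp at ht
  · simp only [Term.app.injEq, heq_eq_eq, Matrix.vecCons_inj, true_and, and_true] at e
    simp [← e] at ht
  · simp only [Term.app.injEq, heq_eq_eq, Matrix.vecCons_inj, true_and, and_true] at e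
    simp [← e.1, Fin.forall_fin_succ] at ht

theorem SafeState.set_stm {p m a q v : Term} (H : SafeState p m a q ff) :
    SafeState p v a q ff where
  ne_pd := H.ne_pd
  ne_launch := H.ne_launch
  trusted hp := by simpa using (H.trusted hp).2.2.2

theorem SafeState.set_pp {p m s a q l t v y : Term} (H : SafeState p m a q l) (ht : Public t)
    (h : Authorizes t a y (smram m s)) : SafeState p m a v l where
  ne_pd := H.ne_pd
  ne_launch := H.ne_launch
  trusted hp := by
    obtain ⟨rfl, rfl, -, -⟩ := H.trusted hp
    exact (ht.not_authorizes _ _ h).elim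

theorem SafeState.set_lock {p m s a q l t v y : Term} (H : SafeState p m a q l) (ht : Public t)
    (h : Authorizes t q y (smram m s)) : SafeState p m a q v where
  ne_pd := H.ne_pd
  ne_launch := H.ne_launch
  trusted hp := by
    obtain ⟨rfl, -, rfl, -⟩ := H.trusted hp
    exact (ht.not_authorizes _ _ h).elim

variable {β : Option ℕ} {f : Sym} {a : Fin f.arity → Term} {r : Term}

theorem Redex.public_of_read (H : Redex β f a r) (ha : ∀ i, Public (a i))
    (hf : f ∈ [.pcr, .int, .cacheR, .stm, .smi, .init, .pp, .lock]) : Public r := by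
  simp only [List.mem_cons, List.not_mem_nil, or_false] at hf
  rcases hf with rfl | rfl | rfl | rfl | rfl | rfl | rfl | rfl <;> simp only [Redex] at H <;>
    have h0 := ha 0
  case inl =>
    obtain ⟨_, _, _, e⟩ := H
    obtain ⟨p, i, k, m, s, a, q, l, e', h⟩ := (e ▸ h0).state_inv
    grind [Matrix.vecCons_inj]
  iterate 4
    obtain ⟨_, _, _, _, e⟩ := H
    obtain ⟨p, i, k, m, s, a, q, l, e', h⟩ := (e ▸ h0).state_inv
    grind [Matrix.vecCons_inj]
  iterate 3
    obtain ⟨_, _, _, _, _, e⟩ := H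
    obtain ⟨p, i, k, m, s, a, q, l, e', h⟩ := (e ▸ h0).state_inv
    grind [Matrix.vecCons_inj]

theorem Redex.public_of_set_int {a : Fin (Sym.arity .set_int) → Term} (H : Redex β .set_int a r)
    (hx : Public (a 0)) (hv : Public (a 2)) : Public r := by
  obtain ⟨_, _, _, _, _, _, _, e, -, rfl, -, rfl⟩ := H
  obtain ⟨p, i, k, m, s, a, q, l, e', h⟩ := (e ▸ hx).state_inv
  grind [public_state, Matrix.vecCons_inj]

theorem Redex.public_of_write (H : Redex β f a r) (ha : ∀ i, Public (a i))
    (hf : f ∈ [.set_int, .cacheW, .flush_smi, .flush_stm, .set_pp, .set_lock]) : Public r := by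
  simp only [List.mem_cons, List.not_mem_nil, or_false] at hf
  rcases hf with rfl | rfl | rfl | rfl | rfl | rfl <;> simp only [Redex] at H
  case inl => exact Redex.public_of_set_int (β := β) H (ha 0) (ha 2)
  case inr.inl =>
    obtain ⟨_, _, _, _, _, _, e, rfl, rfl⟩ := H
    obtain ⟨p, i, k, m, s, a, q, l, e', h⟩ := (e ▸ ha 0).state_inv
    grind [public_state, Matrix.vecCons_inj]
  case inr.inr.inl =>
    obtain ⟨_, _, _, _, _, _, e, rfl⟩ := H
    obtain ⟨p, i, k, m, s, a, q, l, e', h⟩ := (e ▸ ha 0).state_inv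
    grind [public_state, Matrix.vecCons_inj]
  case inr.inr.inr.inl =>
    obtain ⟨_, _, _, _, _, _, _, e, rfl⟩ := H
    obtain ⟨p, i, k, m, s, a, q, l, e', h⟩ := (e ▸ ha 0).state_inv
    grind [public_state, Matrix.vecCons_inj, SafeState.set_stm]
  case inr.inr.inr.inr.inl =>
    obtain ⟨_, _, _, _, _, _, _, _, e, rfl, rfl, ht, rfl⟩ := H
    obtain ⟨p, i, k, m, s, a, q, l, ⟨rfl, rfl, rfl, e'⟩, h⟩ := (e ▸ ha 0).state_inv
    grind [public_state, Matrix.vecCons_inj, SafeState.set_pp]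
  case inr.inr.inr.inr.inr =>
    obtain ⟨_, _, _, _, _, _, _, _, e, rfl, rfl, ht, rfl⟩ := H
    obtain ⟨p, i, k, m, s, a, q, l, ⟨rfl, rfl, rfl, e'⟩, h⟩ := (e ▸ ha 0).state_inv
    grind [public_state, Matrix.vecCons_inj, SafeState.set_lock]

theorem Redex.public (H : Redex β f a r) (hf : f ∉ Sym.priv) (ha : ∀ i, Public (a i)) :
    Public r := by
  cases f <;> first
    | exact H.elim
    | (refine H.public_of_read ha ?_; simp; done)
    | (refine H.public_of_write ha ?_; simp; done)
    | (simp [Sym.priv] at hf; done)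
    | simp only [Redex] at H
  case proj n i =>
    obtain ⟨ts, e, rfl⟩ := H
    exact public_tup.1 (e ▸ ha 0) i
  case sdec =>
    obtain ⟨k, e, -⟩ := H
    exact (e ▸ ha 0).inv.1
  case reset | extend =>
    obtain ⟨_, _, _, _, _, -, e, -⟩ := H
    exact (not_public_tpm_acc (e ▸ ha 1)).elim
  case set_init =>
    obtain ⟨_, _, _, _, _, _, _, -, e, -⟩ := H
    exact (not_public_cpu_acc (e ▸ ha 1)).elim

theorem public_nf_app (hf : f ∉ Sym.priv) (ha : ∀ i, Public (nf (platformTheory β) (a i))) :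
    Public (nf (platformTheory β) (.app f a)) := by
  rcases (isConstructorTheory_platformTheory β).nf_app_cases f a with H | e
  · exact H.redex.public hf ha
  · exact e ▸ .app hf ha

end Knowledge

/-! ### The messages of the protocol -/

section Channels

open Term

/-- The attacker knows the components of a state other than the register and the lock. -/
structure PublicParts (i k m s a q : Term) : Prop where
  int : Public i
  cache : Public k
  stm : Public m
  smi : Public s
  init : Public a
  pp : Public q

/-- The states of a platform during a late launch. -/
abbrev lockedState (p i k m s a q : Term) : Term :=
  state (tpm p) (cpu i k) (smram m s) (drt a q tt)

/-- An upper bound on the messages `T` that are sent on the channel `U`, in the order of a launch.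
The value `φ n` of the name `n` of a request is the value by which the request with this name
extends the register. -/
inductive Msg (φ : Name → Term) : Term → Term → Prop
  | pub {U T : Term} : Public U → Public T → Msg φ U T
  | reset_req {n : Name} {p i k m s a q u : Term} : Public p → PublicParts i k m s a q →
      Public u → φ n = tup ![h u, h m] →
      Msg φ cpu_tpm (tup ![reset_req, .name n, lockedState p i k m s a q])
  | reset_resp {n : Name} {i k m s a q u : Term} : PublicParts i k m s a q → Public u →
      φ n = tup ![h u, h m] →
      Msg φ cpu_tpm (tup ![reset_resp, .name n, lockedState pd i k m s a q])
  | launch_req {n : Name} {i k m s a q u : Term} : PublicParts i k m s a q → Public u →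
      φ n = tup ![h u, h m] →
      Msg φ cpu_tpm (tup ![extend_req, .name n, lockedState pd i k m s a q, tup ![h u, h m]])
  | launch_resp {n : Name} {i k m s a q u : Term} : PublicParts i k m s a q → Public u →
      φ n = tup ![h u, h m] →
      Msg φ cpu_tpm (tup ![extend_resp, .name n, lockedState (launchReg u m) i k m s a q])
  | ext_channel {e : Term} : Public (prog e) →
      Msg φ cpu_tpm (tup ![ext_channel, tpm_ch (prog e)])
  | call {j : ℕ} {n i k m s q q' : Term} : Public n → PublicParts i k m s (prog (entry j)) q →
      Public q' → Msg φ (entry j) (tup ![n, lockedState (launchReg (prog (entry j)) m) i k m s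
        (prog (entry j)) q, tpm_ch (prog (entry j)), q'])
  | init_req {n : Name} {i k m s q v : Term} : PublicParts i k m s (prog Tinit) q → Public v →
      φ n = v → Msg φ (tpm_ch (prog Tinit)) (tup ![extend_req, .name n,
        lockedState (launchReg (prog Tinit) m) i k m s (prog Tinit) q, v])
  | init_resp {n : Name} {i k m s q v : Term} : PublicParts i k m s (prog Tinit) q → Public v →
      φ n = v → Msg φ (tpm_ch (prog Tinit)) (tup ![extend_resp, .name n,
        lockedState (h (tup ![launchReg (prog Tinit) m, v])) i k m s (prog Tinit) q])
  | ret {j : ℕ} {n x : Term} : Public n → Public x → Msg φ (entry j) (tup ![drt_resp, n, x])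
  | start {j : ℕ} {x : Term} : Public x →
      Msg φ (entry j) (tup ![x, tpm_ch (prog (entry j))])
  | open_req {z : Term} : Public z → Msg φ (tpm_ch (prog Tpp)) (tup ![tag_open, z])
  | open_resp {v : Term} : v.Closed → Msg φ (tpm_ch (prog Tpp)) (tup ![tag_plain, v])
  | close_req {n x : Term} : Public n → Public x →
      Msg φ (tpm_ch (prog Tpp)) (tup ![extend_req, n, x, bot])
  | close_resp {n p y z w : Term} : Public n → Public (state (tpm p) y z w) → p ≠ hchain →
      Msg φ (tpm_ch (prog Tpp)) (tup ![extend_resp, n, state (tpm p) y z w])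

variable {φ : Name → Term} {β : Option ℕ}

theorem Msg.public_of_public {U T : Term} (H : Msg φ U T) (hU : Public U) : Public T := by
  cases H <;> first | assumption | simp at hU

theorem Msg.closed {U T : Term} (H : Msg φ U T) : T.Closed := by
  cases H with
  | pub _ h => exact h.closed
  | ext_channel h => simpa [Term.Closed, Fin.forall_fin_succ] using h.closed
  | close_resp hn h _ =>
    simpa [Term.Closed, Fin.forall_fin_succ, hn.closed] using h.closed
  | _ =>
    simp only [Term.Closed, Fin.forall_fin_succ, Matrix.cons_val_zero, Matrix.cons_val_succ,
      IsEmpty.forall_iff, and_true, true_and]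
    grind [PublicParts, Public.closed, Term.Closed]

/-- The typing of the channels of the platform. The name of a request of the processor or of the
loader is created while the variable `measure` holds the value by which the register will be
extended; the protected program extends it by `bot`. -/
def platformTyping (β : Option ℕ) : MessageTyping (platformTheory β) where
  pub := Public
  msg := Msg
  datum l σ := if l = .rand then bot else σ .measure
  pub_name hn := .name (by simp [hn])
  pub_app := public_nf_app
  pub_of_tup := public_tup.1
  msg_of_pub := .pub
  pub_of_msg := Msg.public_of_public
  closed_of_msg := Msg.closed

end Channels

/-! ### Symbolic execution -/

section Execution

open Term

variable {φ : Name → Term} {β : Option ℕ} {σ : Subst}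

@[simp]
theorem var_subst (x : Var) : (Term.var x).subst σ = σ x := rfl

@[simp]
theorem app_subst (f : Sym) (a : Fin f.arity → Term) :
    (Term.app f a).subst σ = .app f (Term.subst σ ∘ a) := rfl

@[simp]
theorem toTerm_bind (x : Var) : (Pat.bind x).toTerm = .var x := rfl

@[simp]
theorem toTerm_eq (t : Term) : (Pat.eq t).toTerm = t := rfl

@[simp]
theorem toTerm_tup {n : ℕ} (ps : Fin n → Pat) : (Pat.tup ps).toTerm = tup (Pat.toTerm ∘ ps) := rfl

@[simp]
theorem mem_bv_bind {x y : Var} : x ∈ (Pat.bind y).bv ↔ x = y := Finset.mem_singleton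

@[simp]
theorem not_mem_bv_eq {x : Var} {t : Term} : x ∉ (Pat.eq t).bv := Finset.notMem_empty x

@[simp]
theorem mem_bv_tup_vecCons {x : Var} {n : ℕ} {p : Pat} {ps : Fin n → Pat} :
    x ∈ (Pat.tup (Matrix.vecCons p ps)).bv ↔ x ∈ p.bv ∨ x ∈ (Pat.tup ps).bv := by
  simp [Pat.bv, Fin.exists_fin_succ]

@[simp]
theorem not_mem_bv_tup_vecEmpty {x : Var} : x ∉ (Pat.tup ![]).bv := by
  simp [Pat.bv]

@[simp]
theorem override_apply {s : Finset Var} {τ : Subst} {x : Var} :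
    Subst.override s τ σ x = if x ∈ s then τ x else σ x := rfl

@[simp]
theorem nf_name (n : Name) : nf (platformTheory β) (.name n) = .name n :=
  (isConstructorTheory_platformTheory β).nf_name n

@[simp]
theorem nf_app {f : Sym} (hf : ¬ f.isDestructor) (a : Fin f.arity → Term) :
    nf (platformTheory β) (.app f a) = .app f (nf (platformTheory β) ∘ a) :=
  (isConstructorTheory_platformTheory β).nf_app_of_not_mem_destructors
    (not_mem_destructors (Bool.eq_false_of_not_eq_true hf)) a

@[simp]
theorem nf_nf (t : Term) :
    nf (platformTheory β) (nf (platformTheory β) t) = nf (platformTheory β) t :=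
  (isConstructorTheory_platformTheory β).nf_nf t

@[simp]
theorem nf_var (x : Var) : nf (platformTheory β) (.var x) = .var x :=
  (isConstructorTheory_platformTheory β).nf_var x

theorem nf_app_of_redex {f : Sym} {a : Fin f.arity → Term} {r : Term}
    (H : platformTheory β (.app f (nf (platformTheory β) ∘ a)) r) :
    nf (platformTheory β) (.app f a) = r :=
  (isConstructorTheory_platformTheory β).nf_app_of_rule H

theorem redex_of_nf_app {f : Sym} {a : Fin f.arity → Term} {r : Term}
    (H : nf (platformTheory β) (.app f a) = r) (hr : ∀ a', r ≠ .app f a') :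
    Redex β f (nf (platformTheory β) ∘ a) r :=
  ((isConstructorTheory_platformTheory β).rule_of_ne H hr).redex

theorem mem_destructors_of_estate {f : Sym} {a : Fin f.arity → Term} {r : Term}
    (H : Estate (.app f a) r) : f ∈ destructors (platformTheory β) :=
  ⟨a, r, platformTheory_iff.2 (.inr (.inr (.inr (.inl H))))⟩

theorem mem_destructors {f : Sym} (hf : f ∈ [.sdec, .unsealData, .get_entry, .pcr, .reset, .extend,
    .set_pcr, .set_int, .set_init, .set_pp, .set_lock]) : f ∈ destructors (platformTheory β) := by
  simp only [List.mem_cons, List.not_mem_nil, or_false] at hf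
  rcases hf with rfl | rfl | rfl | rfl | rfl | rfl | rfl | rfl | rfl | rfl | rfl
  · exact ⟨_, _, platformTheory_iff.2 (.inr (.inl (.sdec bot bot)))⟩
  · exact ⟨_, _, platformTheory_iff.2 (.inr (.inl (.unsealData bot bot)))⟩
  · exact ⟨_, _, platformTheory_iff.2 (.inr (.inr (.inl (.get_entry bot))))⟩
  · exact mem_destructors_of_estate (.pcr bot bot bot bot)
  · exact mem_destructors_of_estate (.reset_ps bot bot bot bot)
  · exact mem_destructors_of_estate (.extend bot bot bot bot bot)
  · exact mem_destructors_of_estate (.set_pcr bot bot bot bot bot)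
  · exact mem_destructors_of_estate (.set_int_cpu bot bot bot bot bot bot)
  · exact mem_destructors_of_estate (.set_init bot bot bot bot bot bot bot)
  · exact mem_destructors_of_estate (.set_pp_cpu bot bot bot bot bot bot bot)
  · exact mem_destructors_of_estate (.set_lock_cpu bot bot bot bot bot bot bot)

/-- The terms substituted for the variables are normal. -/
abbrev Subst.IsNormal (β : Option ℕ) (σ : Subst) : Prop :=
  ∀ x, nf (platformTheory β) (σ x) = σ x

theorem Subst.IsNormal.update (hσ : σ.IsNormal β) (x : Var) {v : Term}
    (hv : nf (platformTheory β) v = v) : Subst.IsNormal β (Function.update σ x v) := fun y => by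
  by_cases h : y = x
  · subst h
    simpa using hv
  · simpa [h] using hσ y

theorem Subst.IsNormal.override {τ : Subst} (hσ : σ.IsNormal β) (hτ : τ.IsNormal β)
    (s : Finset Var) : Subst.IsNormal β (Subst.override s τ σ) := fun x => by
  by_cases h : x ∈ s <;> simp [h, hσ x, hτ x]

theorem safe_letin_destructor {x : Var} {f : Sym} {a : Fin f.arity → Term} {P : Proc}
    (hf : f ∈ destructors (platformTheory β))
    (H : ∀ v, nf (platformTheory β) v = v →
      Redex β f (nf (platformTheory β) ∘ Term.subst σ ∘ a) v →
      v.Closed ∧ (platformTyping β).Safe φ P (Function.update σ x v)) :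
    (platformTyping β).Safe φ (.letin x (.app f a) P) σ := fun hT =>
  H _ (nf_nf _) ((isConstructorTheory_platformTheory β).rule_of_disjoint hf hT).redex

theorem safe_letin {x : Var} {T v : Term} {P : Proc} (hT : nf (platformTheory β) (T.subst σ) = v)
    (hv : v.Closed) (H : (platformTyping β).Safe φ P (Function.update σ x v)) :
    (platformTyping β).Safe φ (.letin x T P) σ := fun _ => by
  rw [hT]
  exact ⟨hv, H⟩

theorem safe_inp {U : Term} {A : Pat} {P : Proc}
    (H : ∀ τ : Subst, τ.IsNormal β → Msg φ (nf (platformTheory β) (U.subst σ))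
        (nf (platformTheory β) (A.toTerm.subst (Subst.override A.bv τ σ))) →
      (platformTyping β).Safe φ P (Subst.override A.bv τ σ)) :
    (platformTyping β).Safe φ (.inp U A P) σ := by
  intro τ hτ hmsg
  have e : Subst.override A.bv (Subst.override A.bv τ .var) σ = Subst.override A.bv τ σ := by
    funext x
    by_cases h : x ∈ A.bv <;> simp [h]
  exact e ▸ H _ (fun x => by by_cases h : x ∈ A.bv <;> simp [h, hτ]) (e.symm ▸ hmsg)

theorem safe_out {U T : Term} {P : Proc} : (platformTyping β).Safe φ (.out U T P) σ ↔
    Msg φ (nf (platformTheory β) (U.subst σ)) (nf (platformTheory β) (T.subst σ)) ∧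
      (platformTyping β).Safe φ P σ := Iff.rfl

end Execution

/-! ### The register -/

section Register

open Term

variable {φ : Name → Term} {β : Option ℕ} {b : ℕ} {U n p x y z v : Term}

@[simp]
theorem public_const : Public os ∧ Public ps ∧ Public pd ∧ Public tt ∧ Public ff ∧ Public bot ∧
    Public reset_req ∧ Public reset_resp ∧ Public extend_req ∧ Public extend_resp ∧
    Public tag_open ∧ Public tag_plain ∧ Public drt_req ∧ Public drt_resp := by
  refine ⟨?_, ?_, ?_, ?_, ?_, ?_, ?_, ?_, ?_, ?_, ?_, ?_, ?_, ?_⟩ <;>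
    exact .const rfl (by simp [Sym.priv])

theorem SafeState.extend {p m a q l v : Term} (H : SafeState p m a q l) :
    SafeState (h (tup ![p, v])) m a q l where
  ne_pd := by simp
  ne_launch e := H.ne_pd (And.left (by simpa using e))
  trusted e := (H.ne_launch (And.left (by simpa [hchain_eq] using e))).elim

theorem Public.extend (H : Public (Term.state (tpm p) x y z)) (hv : Public v) :
    Public (Term.state (tpm (Term.h (Term.tup ![p, v]))) x y z) := by
  obtain ⟨p', i, k, m, s, a, q, l, ⟨e, rfl, rfl, rfl⟩, h⟩ := H.state_inv
  obtain rfl : p = p' := by simpa using e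
  exact public_state.2 ⟨.h (.pair h.1 hv), h.2.1, h.2.2.1, h.2.2.2.1, h.2.2.2.2.1, h.2.2.2.2.2.1,
    h.2.2.2.2.2.2.1, h.2.2.2.2.2.2.2.1, h.2.2.2.2.2.2.2.2.extend⟩

theorem Public.register (H : Public (Term.state (tpm p) x y z)) : Public p := by
  obtain ⟨p', i, k, m, s, a, q, l, ⟨e, -⟩, h, -⟩ := H.state_inv
  obtain rfl : p = p' := by simpa using e
  exact h

/-- The values that the attacker may write into the register of a state. -/
structure SafeRegister (p : Term) : Prop where
  ne_pd : p ≠ pd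
  ne_launch : p ≠ launchReg (prog Tinit) (prog Tstm)
  ne_hchain : p ≠ hchain

theorem Public.set_pcr {p' : Term} (H : Public (Term.state (tpm p) x y z)) (hp' : Public p')
    (h' : SafeRegister p') : Public (Term.state (tpm p') x y z) := by
  obtain ⟨_, i, k, m, s, a, q, l, ⟨-, rfl, rfl, rfl⟩, h⟩ := H.state_inv
  exact public_state.2 ⟨hp', h.2.1, h.2.2.1, h.2.2.2.1, h.2.2.2.2.1, h.2.2.2.2.2.1,
    h.2.2.2.2.2.2.1, h.2.2.2.2.2.2.2.1, h'.ne_pd, h'.ne_launch, fun e => (h'.ne_hchain e).elim⟩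

theorem Public.unlock {a q l : Term} (H : Public (Term.state (tpm p) x y (drt a q l)))
    (hp : p ≠ hchain) : Public (Term.state (tpm p) x y (drt a q ff)) := by
  obtain ⟨p', i, k, m, s, a', q', l', ⟨e, rfl, rfl, e'⟩, h⟩ := H.state_inv
  obtain rfl : p = p' := by simpa using e
  obtain ⟨rfl, rfl, rfl⟩ : a = a' ∧ q = q' ∧ l = l' := by simpa using e'
  exact public_state.2 ⟨h.1, h.2.1, h.2.2.1, h.2.2.2.1, h.2.2.2.2.1, h.2.2.2.2.2.1,
    h.2.2.2.2.2.2.1, by simp, h.2.2.2.2.2.2.2.2.ne_pd, h.2.2.2.2.2.2.2.2.ne_launch,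
    fun e => (hp e).elim⟩

theorem Msg.extend (H : Msg φ U (tup ![extend_req, n, state (tpm p) x y z, v])) :
    Msg φ U (tup ![extend_resp, n, state (tpm (h (tup ![p, v]))) x y z]) := by
  generalize hT : tup ![extend_req, n, state (tpm p) x y z, v] = T at H
  cases H <;> simp only [Nat.succ_eq_add_one, Nat.reduceAdd, Nat.reduceEqDiff, Nat.succ_ne_self,
    Term.app.injEq, Sym.tup.injEq, heq_eq_eq, Matrix.vecCons_inj, reduceCtorEq, true_and, and_true,
    false_and, and_false] at hT
  case pub hU hT' =>
    subst hT
    obtain ⟨hn, hx, hv⟩ : Public n ∧ Public (state (tpm p) x y z) ∧ Public v := by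
      simpa [Fin.forall_fin_succ] using hT'
    exact .pub hU (.tup (by simpa [Fin.forall_fin_succ] using ⟨hn, hx.extend hv⟩))
  case launch_req hs hu hm =>
    obtain ⟨rfl, ⟨rfl, rfl, rfl, rfl⟩, rfl⟩ := hT
    exact .launch_resp hs hu hm
  case init_req hs hv hm =>
    obtain ⟨rfl, ⟨rfl, rfl, rfl, rfl⟩, rfl⟩ := hT
    exact .init_resp hs hv hm
  case close_req hn hx =>
    obtain ⟨rfl, rfl, rfl⟩ := hT
    exact .close_resp hn (hx.extend (by simp)) (by simp [hchain_eq])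

theorem chain_eq_h {v₀ : Term} {vs : List Term} {n : ℕ} (hl : vs.length = n + 1) :
    ∃ vs' v, vs'.length = n ∧ chain v₀ vs = h (tup ![chain v₀ vs', v]) := by
  rcases vs.eq_nil_or_concat with rfl | ⟨vs', v, rfl⟩
  · simp at hl
  · exact ⟨vs', v, by simpa using hl, by simp [chain]⟩

theorem safeRegister_of_is_big (hb : 2 ≤ b)
    (H : nf (platformTheory (some b)) (is_big p) = tt) :
    SafeRegister (nf (platformTheory (some b)) p) := by
  obtain ⟨b', hb', v₀, vs, hl, hp, -⟩ := redex_of_nf_app H (by simp)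
  obtain rfl := Option.mem_some_iff.1 hb'
  obtain ⟨c, rfl⟩ := Nat.exists_eq_add_of_le' hb
  obtain ⟨_, _, hl₁, e₁⟩ := chain_eq_h (v₀ := v₀) hl
  obtain ⟨_, _, hl₂, e₂⟩ := chain_eq_h (v₀ := v₀) hl₁
  obtain ⟨_, _, -, e₃⟩ := chain_eq_h (v₀ := v₀) hl₂
  rw [e₁, e₂, e₃] at hp
  simp only [Function.comp_apply, Matrix.cons_val_zero] at hp
  rw [hp]
  constructor <;> simp [hchain_eq]

theorem nf_is_small_chain_pd {vs : List Term} (hl : vs.length < b) :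
    nf (platformTheory (some b)) (is_small (chain pd vs)) = tt := by
  refine nf_app_of_redex (platformTheory_iff.2 (.inr (.inr (.inr (.inr ⟨b, rfl, ?_⟩)))))
  have hnf : nf (platformTheory (some b)) (chain pd vs) =
      chain pd (vs.map (nf (platformTheory (some b)))) := by
    simpa [Sym.isDestructor] using
      map_chain (φ := nf (platformTheory (some b))) (fun f hf => nf_app (by simp [hf])) pd vs
  rw [comp_vecCons, comp_vecEmpty, hnf]
  exact .small_pd _ (by simpa using hl)

theorem Msg.extend_big (hb : 2 ≤ b)
    (hp : nf (platformTheory (some b)) (is_small p) ≠ tt)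
    (H : Msg φ U (tup ![extend_req, n, state (tpm p) x y z, v])) :
    Public p ∧ Public v ∧ ∀ p', Public p' → SafeRegister p' →
      Msg φ U (tup ![extend_resp, n, state (tpm p') x y z]) := by
  generalize hT : tup ![extend_req, n, state (tpm p) x y z, v] = T at H
  cases H <;> simp only [Nat.succ_eq_add_one, Nat.reduceAdd, Nat.reduceEqDiff, Nat.succ_ne_self,
    Term.app.injEq, Sym.tup.injEq, heq_eq_eq, Matrix.vecCons_inj, reduceCtorEq, true_and, and_true,
    false_and, and_false] at hT
  case pub hU hT' =>
    subst hT
    obtain ⟨hn, hx, hv⟩ : Public n ∧ Public (state (tpm p) x y z) ∧ Public v := by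
      simpa [Fin.forall_fin_succ] using hT'
    exact ⟨hx.register, hv, fun p' hp' h' =>
      .pub hU (.tup (by simpa [Fin.forall_fin_succ] using ⟨hn, hx.set_pcr hp' h'⟩))⟩
  case launch_req =>
    obtain ⟨-, ⟨rfl, -⟩, -⟩ := hT
    exact (hp (nf_is_small_chain_pd (vs := []) (by simp; omega))).elim
  case init_req =>
    obtain ⟨-, ⟨rfl, -⟩, -⟩ := hT
    exact (hp (nf_is_small_chain_pd (vs := [_]) (by simp; omega))).elim
  case close_req hn hx =>
    obtain ⟨rfl, rfl, rfl⟩ := hT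
    exact ⟨hx.register, by simp, fun p' hp' h' => .close_resp hn (hx.set_pcr hp' h') h'.ne_hchain⟩

/-! ### Inversion of the messages -/

theorem Msg.public_of_os {T : Term} (H : Msg φ os T) : Public T :=
  H.public_of_public (by simp)

theorem Msg.reset (H : Msg φ cpu_tpm (tup ![.reset_req, n, state (tpm p) x y z])) :
    Msg φ cpu_tpm (tup ![.reset_resp, n, state (tpm pd) x y z]) := by
  generalize hT : tup ![.reset_req, n, state (tpm p) x y z] = T at H
  generalize hU : cpu_tpm = U at H
  cases H <;> simp only [Nat.succ_eq_add_one, Nat.reduceAdd, Nat.reduceEqDiff, Nat.succ_ne_self,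
    Term.app.injEq, Sym.tup.injEq, heq_eq_eq, Matrix.vecCons_inj, reduceCtorEq, true_and, and_true,
    false_and, and_false] at hT hU
  case pub hU' _ => simp [← hU] at hU'
  case reset_req _ hs hu hm =>
    obtain ⟨rfl, rfl, rfl, rfl, rfl⟩ := hT
    exact .reset_resp hs hu hm

theorem Msg.open_req_inv (hU : ∀ j, U ≠ entry j) (H : Msg φ U (tup ![tag_open, z])) :
    Public z ∧ (Public U ∨ U = tpm_ch (prog Tpp)) := by
  generalize hT : tup ![tag_open, z] = T at H
  cases H <;> simp only [Nat.succ_eq_add_one, Nat.reduceAdd, Nat.reduceEqDiff,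
    Term.app.injEq, Sym.tup.injEq, heq_eq_eq, Matrix.vecCons_inj, reduceCtorEq, true_and, and_true,
    false_and, and_false] at hT
  case pub hU' hT' =>
    subst hT
    exact ⟨public_tup.1 hT' 1, .inl hU'⟩
  case start => exact (hU _ rfl).elim
  case open_req hz => exact ⟨hT ▸ hz, .inr rfl⟩

theorem Msg.reset_resp_inv {n : Name} {u m x : Term} (hn : φ n = tup ![h u, h m])
    (H : Msg φ cpu_tpm (tup ![.reset_resp, .name n, x])) :
    ∃ i k s a q, x = lockedState pd i k m s a q ∧ PublicParts i k m s a q := by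
  generalize hT : tup ![.reset_resp, .name n, x] = T at H
  generalize hU : cpu_tpm = U at H
  cases H <;> simp only [Nat.succ_eq_add_one, Nat.reduceAdd, Nat.reduceEqDiff, Nat.succ_ne_self,
    Term.app.injEq, Sym.tup.injEq, heq_eq_eq, Matrix.vecCons_inj, reduceCtorEq, true_and, and_true,
    false_and, and_false] at hT hU
  case pub hU' _ => simp [← hU] at hU'
  case reset_resp hs _ hm =>
    obtain ⟨⟨rfl⟩, rfl⟩ := hT
    obtain ⟨rfl, rfl⟩ : _ ∧ _ := by simpa using hn.symm.trans hm
    exact ⟨_, _, _, _, _, rfl, hs⟩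

theorem Msg.launch_resp_inv {n : Name} {u m x : Term} (hn : φ n = tup ![h u, h m])
    (H : Msg φ cpu_tpm (tup ![extend_resp, .name n, x])) :
    ∃ i k s a q, x = lockedState (launchReg u m) i k m s a q ∧ PublicParts i k m s a q := by
  generalize hT : tup ![extend_resp, .name n, x] = T at H
  generalize hU : cpu_tpm = U at H
  cases H <;> simp only [Nat.succ_eq_add_one, Nat.reduceAdd, Nat.reduceEqDiff, Nat.succ_ne_self,
    Term.app.injEq, Sym.tup.injEq, heq_eq_eq, Matrix.vecCons_inj, reduceCtorEq, true_and, and_true,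
    false_and, and_false] at hT hU
  case pub hU' _ => simp [← hU] at hU'
  case launch_resp hs _ hm =>
    obtain ⟨⟨rfl⟩, rfl⟩ := hT
    obtain ⟨rfl, rfl⟩ : _ ∧ _ := by simpa using hn.symm.trans hm
    exact ⟨_, _, _, _, _, rfl, hs⟩

theorem Msg.ret_inv (H : Msg φ U (tup ![drt_resp, n, x])) : Public x := by
  generalize hT : tup ![drt_resp, n, x] = T at H
  cases H <;> simp only [Nat.succ_eq_add_one, Nat.reduceAdd, Nat.reduceEqDiff, Nat.succ_ne_self,
    Term.app.injEq, Sym.tup.injEq, heq_eq_eq, Matrix.vecCons_inj, reduceCtorEq, true_and, and_true,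
    false_and, and_false] at hT
  case pub _ hT' =>
    subst hT
    exact public_tup.1 hT' 2
  case ret _ hx => exact hT.2 ▸ hx

theorem Msg.call_inv {j : ℕ} {t q' : Term} (H : Msg φ (entry j) (tup ![n, x, t, q'])) :
    Public n ∧ Public q' ∧ t = tpm_ch (prog (entry j)) ∧
      ∃ i k m s q, x = lockedState (launchReg (prog (entry j)) m) i k m s (prog (entry j)) q ∧
        PublicParts i k m s (prog (entry j)) q := by
  generalize hT : tup ![n, x, t, q'] = T at H
  generalize hU : entry j = U at H
  cases H <;> simp only [Nat.succ_eq_add_one, Nat.reduceAdd, Nat.reduceEqDiff, Nat.succ_ne_self,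
    Term.app.injEq, Sym.tup.injEq, heq_eq_eq, Matrix.vecCons_inj, reduceCtorEq, true_and, and_true,
    false_and, Sym.entry.injEq] at hT hU
  case pub hU' _ => simp [← hU] at hU'
  case call hn hs hq =>
    obtain rfl := hU
    obtain ⟨rfl, rfl, rfl, rfl⟩ := hT
    exact ⟨hn, hq, rfl, _, _, _, _, _, rfl, hs⟩

theorem Msg.init_resp_inv {n : Name} {v x : Term} (hn : φ n = v)
    (H : Msg φ (tpm_ch (prog Tinit)) (tup ![extend_resp, .name n, x])) :
    ∃ i k m s q, x = lockedState (h (tup ![launchReg (prog Tinit) m, v])) i k m s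
      (prog Tinit) q ∧ PublicParts i k m s (prog Tinit) q := by
  generalize hT : tup ![extend_resp, .name n, x] = T at H
  generalize hU : tpm_ch (prog Tinit) = U at H
  cases H <;> simp only [Nat.succ_eq_add_one, Nat.reduceAdd, Nat.reduceEqDiff, Nat.succ_ne_self,
    Term.app.injEq, Sym.tup.injEq, heq_eq_eq, Matrix.vecCons_inj, reduceCtorEq, true_and, and_true,
    false_and, and_false, Sym.entry.injEq, zero_ne_one] at hT hU
  case pub hU' _ => simp [← hU] at hU'
  case init_resp hs _ hm =>
    obtain ⟨⟨rfl⟩, rfl⟩ := hT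
    obtain rfl := hn.symm.trans hm
    exact ⟨_, _, _, _, _, rfl, hs⟩

theorem Msg.start_inv {j : ℕ} {t : Term} (H : Msg φ (entry j) (tup ![x, t])) :
    Public x ∧ t = tpm_ch (prog (entry j)) := by
  generalize hT : tup ![x, t] = T at H
  generalize hU : entry j = U at H
  cases H <;> simp only [Nat.succ_eq_add_one, Nat.reduceAdd, Nat.reduceEqDiff,
    Term.app.injEq, Sym.tup.injEq, heq_eq_eq, Matrix.vecCons_inj, reduceCtorEq, true_and, and_true,
    false_and, Sym.entry.injEq] at hT hU
  case pub hU' _ => simp [← hU] at hU'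
  case start hx =>
    obtain rfl := hU
    obtain ⟨rfl, rfl⟩ := hT
    exact ⟨hx, rfl⟩

theorem Msg.close_resp_inv (H : Msg φ (tpm_ch (prog Tpp)) (tup ![extend_resp, n, x])) :
    ∃ p y z w, x = state (tpm p) y z w ∧ Public x ∧ p ≠ hchain := by
  generalize hT : tup ![extend_resp, n, x] = T at H
  generalize hU : tpm_ch (prog Tpp) = U at H
  cases H <;> simp only [Nat.succ_eq_add_one, Nat.reduceAdd, Nat.reduceEqDiff, Nat.succ_ne_self,
    Term.app.injEq, Sym.tup.injEq, heq_eq_eq, Matrix.vecCons_inj, reduceCtorEq, true_and, and_true,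
    false_and, and_false, Sym.entry.injEq, one_ne_zero] at hT hU
  case pub hU' _ => simp [← hU] at hU'
  case close_resp _ hx hp =>
    obtain ⟨rfl, rfl⟩ := hT
    exact ⟨_, _, _, _, rfl, hx, hp⟩

theorem Msg.call_of_prog {e i k m s q q' : Term} (he : Public (prog e)) (hn : Public n)
    (hs : PublicParts i k m s (prog e) q) (hq : Public q') :
    Msg φ e (tup ![n, lockedState (launchReg (prog e) m) i k m s (prog e) q,
      tpm_ch (prog e), q']) := by
  rcases public_prog.1 he with he | ⟨j, rfl⟩
  · have hstate : Public (lockedState (launchReg (prog e) m) i k m s (prog e) q) := by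
      refine .state (.launchReg hs.init hs.stm) hs.int hs.cache hs.stm hs.smi hs.init hs.pp
        (by simp) ⟨by simp, fun h => ?_, fun h => ?_⟩
      · simp only [app.injEq, heq_eq_eq, Matrix.vecCons_inj, true_and, and_true] at h
        simp [h.1] at he
      · simp [hchain_eq] at h
    exact .pub he (.tup (by simpa [Fin.forall_fin_succ] using ⟨hn, hstate, .tpm_ch he, hq⟩))
  · exact .call hn hs hq

theorem Msg.start_of_prog {e : Term} (he : Public (prog e)) (hx : Public x) :
    Msg φ e (tup ![x, tpm_ch (prog e)]) := by
  rcases public_prog.1 he with he | ⟨j, rfl⟩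
  · exact .pub he (.pair hx (.tpm_ch he))
  · exact .start hx

end Register

/-! ### The processes of the protocol -/

section Protocol

open Term

attribute [local simp] Sym.isDestructor

variable {φ : Name → Term} {β : Option ℕ} {b : ℕ} {σ : Subst}

theorem safe_pcrReset (hσ : σ.IsNormal β)
    (h : σ .ch = cpu_tpm ∧ σ .rv = pd ∨ σ .ch = os ∧ σ .rv = ps) :
    (platformTyping β).Safe φ pcrReset σ := by
  refine safe_inp fun τ hτ Hreq =>
    safe_letin_destructor (mem_destructors (by simp)) fun v hv Hv => ?_
  replace Hreq : Msg φ (σ .ch) (tup ![reset_req, τ .nonce, τ .pf_state]) := by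
    simpa [hσ _, hτ _] using Hreq
  obtain ⟨p, x, y, z, e, rfl⟩ : ∃ p x y z, τ .pf_state = state (tpm p) x y z ∧
      v = state (tpm (σ .rv)) x y z := by
    obtain ⟨_, _, _, _, _, e, -, e', -, rfl⟩ := Hv
    simp only [← e']
    exact ⟨_, _, _, _, by simpa [hτ _] using e, by simp [hσ _]⟩
  have Hresp : Msg φ (σ .ch) (tup ![reset_resp, τ .nonce, state (tpm (σ .rv)) x y z]) := by
    rw [e] at Hreq
    rcases h with ⟨h₁, h₂⟩ | ⟨h₁, h₂⟩ <;> rw [h₁] at Hreq ⊢ <;> rw [h₂]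
    · exact Hreq.reset
    · have hpub := public_tup.1 Hreq.public_of_os
      refine .pub (by simp) (.tup ?_)
      have := (hpub 2).set_pcr (p' := ps) (by simp) ⟨by simp, by simp, by simp [hchain_eq]⟩
      simpa [Fin.forall_fin_succ] using ⟨hpub 1, this⟩
  refine ⟨Hresp.closed 2, safe_out.2 ⟨?_, trivial⟩⟩
  simpa (decide := true) [hσ _, hτ _, hv] using Hresp

theorem safe_pcrExtend (hσ : σ.IsNormal β) : (platformTyping β).Safe φ pcrExtend σ := by
  refine safe_inp fun τ hτ Hreq =>
    safe_letin_destructor (mem_destructors (by simp)) fun v hv Hv => ?_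
  replace Hreq : Msg φ (σ .ch) (tup ![extend_req, τ .nonce, τ .pf_state, τ .v]) := by
    simpa [hσ _, hτ _] using Hreq
  obtain ⟨p, x, y, z, e, rfl⟩ : ∃ p x y z, τ .pf_state = state (tpm p) x y z ∧
      v = state (tpm (h (tup ![p, τ .v]))) x y z := by
    obtain ⟨_, _, _, _, _, e, -, rfl, rfl⟩ := Hv
    exact ⟨_, _, _, _, by simpa [hτ _] using e, by simp [hτ _]⟩
  have Hresp := (e ▸ Hreq).extend
  refine ⟨Hresp.closed 2, safe_out.2 ⟨?_, trivial⟩⟩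
  simpa (decide := true) [hσ _, hτ _, hv] using Hresp

theorem safe_pcrExtendSmall (hσ : σ.IsNormal β)
    (Hreq : Msg φ (σ .ch) (tup ![extend_req, σ .nonce, σ .pf_state, σ .val])) :
    (platformTyping β).Safe φ pcrExtendSmall σ := by
  refine safe_letin_destructor (mem_destructors (by simp)) fun v hv Hv => ?_
  obtain ⟨p, x, y, z, e, rfl⟩ : ∃ p x y z, σ .pf_state = state (tpm p) x y z ∧
      v = state (tpm (h (tup ![p, σ .val]))) x y z := by
    obtain ⟨_, _, _, _, _, e, -, rfl, rfl⟩ := Hv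
    exact ⟨_, _, _, _, by simpa [hσ _] using e, by simp [hσ _]⟩
  have Hresp := (e ▸ Hreq).extend
  refine ⟨Hresp.closed 2, safe_out.2 ⟨?_, trivial⟩⟩
  simpa (decide := true) [hσ _, hv] using Hresp

theorem safe_pcrExtendBig (hb : 2 ≤ b) {x y z : Term} (hσ : σ.IsNormal (some b))
    (hx : σ .pf_state = state (tpm (σ .pcr)) x y z)
    (hp : nf (platformTheory (some b)) (is_small (σ .pcr)) ≠ tt)
    (Hreq : Msg φ (σ .ch) (tup ![extend_req, σ .nonce, σ .pf_state, σ .val])) :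
    (platformTyping (some b)).Safe φ pcrExtendBig σ := by
  obtain ⟨hpcr, hval, Hresp⟩ := (hx ▸ Hreq).extend_big hb hp
  refine safe_out.2 ⟨.pub (by simp) (by simpa [hσ _] using hpcr.pair hval), ?_⟩
  refine safe_inp fun τ hτ Hos => ⟨fun hbig => ?_, fun _ => trivial⟩
  replace Hos : Msg φ os (τ .new_pcr) := by simpa [hτ _] using Hos
  replace hbig : SafeRegister (τ .new_pcr) := by
    have := safeRegister_of_is_big (p := τ .new_pcr) hb (by simpa using hbig)
    rwa [hτ] at this
  specialize Hresp _ Hos.public_of_os hbig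
  refine safe_letin_destructor (mem_destructors (by simp)) fun v hv Hv => ?_
  obtain rfl : v = state (tpm (τ .new_pcr)) x y z := by
    obtain ⟨p, x', y', z', _, e, -, rfl, rfl⟩ := Hv
    replace e : σ .pf_state = state (tpm p) x' y' z' := by simpa [hσ _] using e
    obtain ⟨-, rfl, rfl, rfl⟩ : _ ∧ x = x' ∧ y = y' ∧ z = z' := by simpa using hx.symm.trans e
    simp [hτ _]
  refine ⟨Hresp.closed 2, safe_out.2 ⟨?_, trivial⟩⟩
  simpa (decide := true) [hσ _, hτ _, hv] using Hresp

theorem safe_pcrExtendB (hb : 2 ≤ b) (hσ : σ.IsNormal (some b)) :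
    (platformTyping (some b)).Safe φ pcrExtendB σ := by
  refine safe_inp fun τ hτ Hreq =>
    safe_letin_destructor (mem_destructors (by simp)) fun p hp Hp => ?_
  replace Hreq : Msg φ (σ .ch) (tup ![extend_req, τ .nonce, τ .pf_state, τ .val]) := by
    simpa [hσ _, hτ _] using Hreq
  obtain ⟨x, y, z, e⟩ : ∃ x y z, τ .pf_state = state (tpm p) x y z := by
    obtain ⟨_, _, _, e⟩ := Hp
    exact ⟨_, _, _, by simpa [hτ _] using e⟩
  have hclosed : p.Closed := by
    have := Hreq.closed 2
    rw [show _ = _ from e] at this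
    exact this 0 0
  refine ⟨hclosed, fun _ => ?_, fun hsmall => ?_⟩
  · exact safe_pcrExtendSmall ((hσ.override hτ _).update _ hp) (by simpa using Hreq)
  · exact safe_pcrExtendBig hb ((hσ.override hτ _).update _ hp) (by simpa using e)
      (by simpa using hsmall) (by simpa using Hreq)

theorem safe_unsealProc (hσ : σ.IsNormal β) (hch : ∀ j, σ .ch ≠ entry j)
    (hpcr : Public (σ .ch) → nf (platformTheory β) (Term.pcr (σ .pf_state)) ≠ hchain) :
    (platformTyping β).Safe φ unsealProc σ := by
  refine safe_inp fun τ hτ Hreq =>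
    safe_letin_destructor (mem_destructors (by simp)) fun v hv Hv => ?_
  replace Hreq : Msg φ (σ .ch) (tup ![tag_open, τ .blob]) := by
    simpa [hσ _, hτ _] using Hreq
  obtain ⟨hblob, hch⟩ := Hreq.open_req_inv hch
  obtain ⟨k, e, rfl⟩ := Hv
  replace e : τ .blob = sealData v (nf (platformTheory β) (Term.pcr (σ .pf_state))) := by
    simpa [hτ _] using e
  rw [e] at hblob
  refine ⟨hblob.closed 0, safe_out.2 ⟨?_, trivial⟩⟩
  suffices Msg φ (σ .ch) (tup ![tag_plain, v]) by simpa (decide := true) [hσ _, hv] using this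
  rcases hch with hch | hch
  · have hpub := hblob.inv.2.resolve_right fun h => hpcr hch h.2
    exact .pub hch (.pair (by simp) (by simpa using hpub))
  · rw [hch]
    exact .open_resp (hblob.closed 0)

theorem nf_app_of_estate {f : Sym} {a : Fin f.arity → Term} {r : Term}
    (H : Estate (.app f (nf (platformTheory β) ∘ a)) r) : nf (platformTheory β) (.app f a) = r :=
  nf_app_of_redex (platformTheory_iff.2 (.inr (.inr (.inr (.inl H)))))

section StateComponents

variable {t p x y z w v : Term}

theorem nf_pcr_of_eq_state (ht : nf (platformTheory β) t = state (tpm p) x y z) :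
    nf (platformTheory β) (Term.pcr t) = p :=
  nf_app_of_estate (by rw [comp_vecCons, comp_vecEmpty, ht]; exact .pcr ..)

theorem nf_stm_of_eq_state (ht : nf (platformTheory β) t = state x y (smram z w) v) :
    nf (platformTheory β) (stm t) = z :=
  nf_app_of_estate (by rw [comp_vecCons, comp_vecEmpty, ht]; exact .stm ..)

theorem nf_pp_of_eq_state (ht : nf (platformTheory β) t = state x y z (drt w v p)) :
    nf (platformTheory β) (Term.pp t) = v :=
  nf_app_of_estate (by rw [comp_vecCons, comp_vecEmpty, ht]; exact .pp ..)

theorem nf_lock_of_eq_state (ht : nf (platformTheory β) t = state x y z (drt w v p)) :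
    nf (platformTheory β) (lock t) = p :=
  nf_app_of_estate (by rw [comp_vecCons, comp_vecEmpty, ht]; exact .lock ..)

end StateComponents

theorem safe_unsealProc_of_locked {p i k m s a q : Term} (hσ : σ.IsNormal β)
    (hx : σ .pf_state = lockedState p i k m s a q) (hs : SafeState p m a q tt)
    (hq : q.Closed) :
    (platformTyping β).Safe φ (.letin .ch (tpm_ch (.pp (V .pf_state))) unsealProc) σ := by
  have hx' : nf (platformTheory β) (σ .pf_state) = lockedState p i k m s a q := (hσ _).trans hx
  have hq' : nf (platformTheory β) q = q := by
    rw [← nf_pp_of_eq_state hx', nf_nf]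
  refine safe_letin (v := tpm_ch q) (by simp [nf_pp_of_eq_state hx'])
    (by simpa [Term.Closed] using hq) ?_
  refine safe_unsealProc (hσ.update _ (by simp [hq'])) (by simp) fun hpub hp => ?_
  obtain ⟨-, -, rfl, -⟩ := hs.trusted ((nf_pcr_of_eq_state (by simpa using hx')).symm.trans hp)
  simp at hpub

theorem safe_unsealProc_of_unlocked (hσ : σ.IsNormal β) (hx : Public (σ .pf_state))
    (hlock : nf (platformTheory β) (lock (σ .pf_state)) ≠ tt) :
    (platformTyping β).Safe φ (.letin .ch os unsealProc) σ := by
  refine safe_letin (v := os) (by simp) (Public.closed (by simp)) ?_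
  refine safe_unsealProc (hσ.update _ (by simp)) (by simp) fun _ hp => hlock ?_
  obtain ⟨_, _, _, e⟩ := redex_of_nf_app (f := .pcr) hp (by simp [hchain_eq])
  replace e : σ .pf_state = _ := (hσ _).symm.trans (by simpa using e)
  obtain ⟨p, i, k, m, s, a, q, l, ⟨hp', rfl, rfl, rfl⟩, -, -, -, -, -, -, -, -, hs⟩ :=
    (e ▸ hx).state_inv
  obtain ⟨-, -, -, rfl⟩ := hs.trusted (by simpa using hp'.symm)
  exact nf_lock_of_eq_state ((hσ _).trans e)

theorem safe_tpmUnseal (hσ : σ.IsNormal β) : (platformTyping β).Safe φ tpmUnseal σ := by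
  refine safe_inp fun τ hτ Hst => ?_
  replace Hst : Msg φ os (τ .pf_state) := by simpa [hτ _] using Hst
  have hpub := Hst.public_of_os
  refine ⟨fun hlock => ?_, fun hlock => ?_⟩
  · obtain ⟨_, _, _, _, _, e⟩ := redex_of_nf_app (f := .lock) (r := tt) (by simpa using hlock)
      (by simp)
    replace e : τ .pf_state = _ := (hτ _).symm.trans (by simpa using e)
    obtain ⟨p, i, k, m, s, a, q, l, ⟨rfl, rfl, rfl, hd⟩, -, -, -, -, -, -, hq, -, hs⟩ :=
      (e ▸ hpub).state_inv
    obtain ⟨rfl, rfl, rfl⟩ : _ ∧ _ ∧ tt = l := by simpa using hd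
    exact safe_unsealProc_of_locked (hσ.override hτ _) (by simpa using e) hs hq.closed
  · exact safe_unsealProc_of_unlocked (hσ.override hτ _) (by simpa using hpub)
      (by simpa using hlock)

theorem safe_tpmReset (hσ : σ.IsNormal β) : (platformTyping β).Safe φ tpmReset σ := by
  constructor
  · refine safe_letin (v := cpu_tpm) (by simp) (fun i => i.elim0) ?_
    refine safe_letin (v := pd) (by simp) (Public.closed (by simp)) ?_
    exact safe_pcrReset ((hσ.update _ (by simp)).update _ (by simp)) (.inl (by simp))
  · refine safe_letin (v := os) (by simp) (Public.closed (by simp)) ?_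
    refine safe_letin (v := ps) (by simp) (Public.closed (by simp)) ?_
    exact safe_pcrReset ((hσ.update _ (by simp)).update _ (by simp)) (.inr (by simp))

theorem safe_tpmExtend {ext : Proc} (hσ : σ.IsNormal β)
    (H : ∀ σ : Subst, σ.IsNormal β → (platformTyping β).Safe φ ext σ) :
    (platformTyping β).Safe φ (tpmExtend ext) σ := by
  refine ⟨?_, ?_, safe_inp fun τ hτ _ => H _ (hσ.override hτ _)⟩
  · exact safe_letin (v := cpu_tpm) (by simp) (fun i => i.elim0) (H _ (hσ.update _ (by simp)))
  · exact safe_letin (v := os) (by simp) (Public.closed (by simp)) (H _ (hσ.update _ (by simp)))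

theorem safe_tpmProc {ext : Proc} (hσ : σ.IsNormal β)
    (H : ∀ σ : Subst, σ.IsNormal β → (platformTyping β).Safe φ ext σ) :
    (platformTyping β).Safe φ (tpmProc ext) σ :=
  ⟨safe_tpmReset hσ, safe_tpmExtend hσ H, safe_tpmUnseal hσ⟩

theorem safe_dataProc : (platformTyping β).Safe φ dataProc σ := by
  intro n hn _ n' hn' _
  obtain ⟨l, j⟩ := n
  obtain rfl : l = .kpp := hn
  have hsenc : Public (senc (.name n') (.name ⟨.kpp, j⟩)) := .senc (.name (by simp [hn']))
  refine safe_out.2 ⟨.pub (by simp) (by simpa using hsenc), ?_⟩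
  have hseal : Public (sealData (.name ⟨.kpp, j⟩) hchain) := .sealData
  refine safe_letin (v := sealData (.name ⟨.kpp, j⟩) hchain) (by simp [chain]) hseal.closed ?_
  exact safe_out.2 ⟨.pub (by simp) (by simpa [hchain_eq] using hseal), trivial⟩

theorem safe_setupProc : (platformTyping β).Safe φ setupProc σ := by
  refine safe_inp fun τ hτ Hm => safe_inp fun τ' hτ' Hs => safe_out.2 ⟨.pub (by simp) ?_, ?_⟩
  · replace Hm : Msg φ os (τ .xstm) := by simpa [hτ _] using Hm
    replace Hs : Msg φ os (τ' .xsmi) := by simpa [hτ' _] using Hs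
    have hstate : Public (state (tpm ps) (cpu tt bot) (smram (τ .xstm) (τ' .xsmi))
        (drt bot bot ff)) :=
      .state (by simp) (by simp) (by simp) Hm.public_of_os Hs.public_of_os (by simp) (by simp)
        (by simp) ⟨by simp, by simp, by simp [hchain_eq]⟩
    simpa [hτ _, hτ' _] using hstate
  · refine safe_inp fun τi hτi Hi => safe_inp fun τq hτq Hq => safe_inp fun τx hτx Hx =>
      safe_out.2 ⟨.pub (by simp) ?_, trivial⟩
    replace Hi : Msg φ os (τi .init) := by simpa [hτi _] using Hi
    replace Hq : Msg φ os (τq .pp) := by simpa [hτq _] using Hq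
    replace Hx : Msg φ os (τx .pf_state) := by simpa [hτx _] using Hx
    simpa [hτi _, hτq _, hτx _, Fin.forall_fin_succ] using
      ⟨Hi.public_of_os, Hq.public_of_os, Hx.public_of_os⟩

theorem PublicParts.public_lockedState_measured {i k m s q q' : Term}
    (hs : PublicParts i k m s (prog Tinit) q) (hq' : Public q') :
    Public (lockedState (h (tup ![launchReg (prog Tinit) m, h q'])) i k m s (prog Tinit) q') := by
  refine .state ((hs.init.launchReg hs.stm).pair hq'.h).h hs.int hs.cache hs.stm hs.smi hs.init hq'
    (by simp) ⟨by simp, by simp, fun e => ?_⟩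
  obtain ⟨rfl, rfl⟩ : m = prog Tstm ∧ q' = prog Tpp := by simpa [hchain_eq] using e
  simp

theorem safe_initProc : (platformTyping β).Safe φ initProc σ := by
  refine safe_out.2 ⟨.pub (by simp) (by simpa using .prog), safe_out.2
    ⟨.pub (by simp) (by simpa using .prog), safe_inp fun τ hτ Hcall => ?_⟩⟩
  replace Hcall : Msg φ Tinit (tup ![τ .nonce, τ .pf_st, τ .tpmc, τ .pp]) := by
    simpa [hτ _] using Hcall
  obtain ⟨hn, hq, hc, i, k, m, s, q, hx, hs⟩ := Hcall.call_inv
  refine safe_letin (v := h (τ .pp)) (by simp [hτ _]) hq.h.closed ?_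
  intro n₁ hl hφ
  replace hφ : φ n₁ = h (τ .pp) := by simpa [platformTyping, hl] using hφ
  have Hreq : Msg φ (τ .tpmc) (tup ![extend_req, .name n₁, τ .pf_st, h (τ .pp)]) := by
    rw [hc, hx]
    exact .init_req hs hq.h hφ
  refine safe_out.2 ⟨by simpa [hτ _] using Hreq, safe_inp fun τ' hτ' Hresp => ?_⟩
  replace Hresp : Msg φ (tpm_ch (prog Tinit)) (tup ![extend_resp, .name n₁, τ' .ext_st]) := by
    simpa [hτ' _, hτ _, ← hc] using Hresp
  obtain ⟨i, k, m, s, q, hx', hs⟩ := Hresp.init_resp_inv hφ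
  refine safe_letin_destructor (mem_destructors (by simp)) fun y hy Hy => ?_
  obtain rfl : y = lockedState (h (tup ![launchReg (prog Tinit) m, h (τ .pp)])) i k m s
      (prog Tinit) (τ .pp) := by
    obtain ⟨x₁, x₂, x₃, a, q₀, l, _, _, e, -, rfl, -, rfl⟩ := Hy
    replace e : τ' .ext_st = state x₁ x₂ x₃ (drt a q₀ l) := by simpa [hτ' _] using e
    obtain ⟨rfl, rfl, rfl, rfl, -, rfl⟩ :
        _ = x₁ ∧ _ = x₂ ∧ _ = x₃ ∧ _ = a ∧ _ = q₀ ∧ _ = l := by simpa using hx'.symm.trans e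
    simp [hτ _]
  have hpub := hs.public_lockedState_measured hq
  refine ⟨hpub.closed, safe_out.2 ⟨?_, safe_out.2 ⟨.pub (by simp) ?_, trivial⟩⟩⟩
  · simpa [hy, hτ _] using Msg.ret (φ := φ) (j := 0) hn hpub
  · simpa [hy] using hpub

/-- The part of the protected program `ppProc` that overwrites the register and releases the lock,
after the messages have been decrypted. -/
def ppClose : Proc :=
  .new .rand .rand <|
  .out (V .tpmc) (.tup ![.extend_req, V .rand, V .pf_st, .bot]) <|
  .inp (V .tpmc) (.tup ![.eq .extend_resp, .eq (V .rand), .bind .exts]) <|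
  .letin .ends (.set_lock (V .exts) .Tpp .ff) <|
  .out .os (V .ends) .nil

theorem safe_ppClose (hσ : σ.IsNormal β) (hx : Public (σ .pf_st))
    (hc : σ .tpmc = tpm_ch (prog Tpp)) : (platformTyping β).Safe φ ppClose σ := by
  intro n hl _
  have hn : Public (.name n) := .name (by simp [hl])
  have Hreq : Msg φ (σ .tpmc) (tup ![extend_req, .name n, σ .pf_st, bot]) := by
    rw [hc]
    exact .close_req hn hx
  refine safe_out.2 ⟨by simpa [hσ _] using Hreq, safe_inp fun τ hτ Hresp => ?_⟩
  replace Hresp : Msg φ (tpm_ch (prog Tpp)) (tup ![extend_resp, .name n, τ .exts]) := by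
    simpa [hτ _, hσ _, ← hc] using Hresp
  obtain ⟨p, y, z, w, e, hpub, hp⟩ := Hresp.close_resp_inv
  refine safe_letin_destructor (mem_destructors (by simp)) fun v hv Hv => ?_
  obtain ⟨a, q, l, hw, rfl⟩ : ∃ a q l, w = drt a q l ∧ v = state (tpm p) y z (drt a q ff) := by
    obtain ⟨x₁, x₂, x₃, a, q, l, _, _, e', -, rfl, -, rfl⟩ := Hv
    replace e' : τ .exts = state x₁ x₂ x₃ (drt a q l) := by simpa [hτ _] using e'
    obtain ⟨rfl, rfl, rfl, rfl⟩ : tpm p = x₁ ∧ y = x₂ ∧ z = x₃ ∧ w = drt a q l := by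
      simpa using e.symm.trans e'
    exact ⟨a, q, l, rfl, by simp⟩
  have hunlocked := ((show _ = _ from e.trans (by rw [hw])) ▸ hpub).unlock hp
  refine ⟨hunlocked.closed, safe_out.2 ⟨.pub (by simp) ?_, trivial⟩⟩
  simpa [hv] using hunlocked

theorem safe_ppProc (hσ : σ.IsNormal β) : (platformTyping β).Safe φ ppProc σ := by
  refine safe_out.2 ⟨.pub (by simp) (by simpa using .prog), safe_inp fun τ hτ Hstart => ?_⟩
  replace Hstart : Msg φ Tpp (tup ![τ .pf_state0, τ .tpmc]) := by simpa [hτ _] using Hstart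
  obtain ⟨hx, hc⟩ := Hstart.start_inv
  refine safe_letin_destructor (mem_destructors (by simp)) fun y hy Hy => ?_
  have hpub : Public y := Hy.public_of_set_int (by simpa [hτ _] using hx) (by simp)
  refine ⟨hpub.closed, safe_out.2 ⟨.pub (by simp) (by simpa [hy] using hpub),
    safe_inp fun τz hz Hz => safe_inp fun τw hw Hw => ?_⟩⟩
  replace Hz : Msg φ os (τz .xblob) := by simpa [hz _] using Hz
  replace Hw : Msg φ os (τw .xenc) := by simpa [hw _] using Hw
  have Hopen : Msg φ (τ .tpmc) (tup ![tag_open, τz .xblob]) := by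
    rw [hc]
    exact .open_req Hz.public_of_os
  refine safe_out.2 ⟨by simpa [hz _, hτ _] using Hopen, safe_inp fun τk hk _ =>
    safe_letin_destructor (mem_destructors (by simp)) fun v hv Hv => ?_⟩
  obtain ⟨k, e, -⟩ := Hv
  replace e : τw .xenc = senc v k := by simpa [hw _] using e
  have hmess : Public v := (e ▸ Hw.public_of_os).inv.1
  refine ⟨hmess.closed, safe_out.2 ⟨.pub (by simp) (by simpa [hv] using hmess), ?_⟩⟩
  exact safe_ppClose ((((((hσ.override hτ _).update _ hy).override hz _).override hw _).override hk
    _).update _ hv) (by simpa using hpub) (by simpa using hc)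

/-- The part of the processor `cpuProc` after the loader has been called: it waits for the loader to
return and starts the protected program. -/
def cpuReturn : Proc :=
  .inp (V .einit) (.tup ![.eq .drt_resp, .eq (V .nonce), .bind .new_state]) <|
  .letin .epp (.get_entry (.pp (V .new_state))) <|
  .out (V .epp) (.tup ![V .new_state, .tpm_ch (.prog (V .epp))]) <|
  .out .cpu_tpm (.tup ![.ext_channel, .tpm_ch (.prog (V .epp))]) .nil

theorem safe_cpuReturn (hσ : σ.IsNormal β) : (platformTyping β).Safe φ cpuReturn σ := by
  refine safe_inp fun τ hτ Hret =>
    safe_letin_destructor (mem_destructors (by simp)) fun e he He => ?_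
  replace Hret : Msg φ (σ .einit) (tup ![drt_resp, σ .nonce, τ .new_state]) := by
    simpa [hσ _, hτ _] using Hret
  have hx := Hret.ret_inv
  have hprog : Public (prog e) := by
    have : Public (nf (platformTheory β) (Term.pp (τ .new_state))) :=
      public_nf_app (by simp [Sym.priv]) (by simpa [Fin.forall_fin_succ, hτ _] using hx)
    rwa [← show nf (platformTheory β) (Term.pp (τ .new_state)) = prog e by
      simpa [Redex] using He]
  refine ⟨hprog.closed 0, safe_out.2 ⟨?_, safe_out.2 ⟨?_, trivial⟩⟩⟩
  · simpa [he, hτ _] using Msg.start_of_prog (φ := φ) hprog hx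
  · simpa [he] using Msg.ext_channel (φ := φ) hprog

/-- The part of the processor `cpuProc` after the measurement: it stores the loader in the state and
calls it. -/
def cpuCall : Proc :=
  .letin .s3 (.set_init (V .s2) .cpu_acc (V .init)) <|
  .letin .einit (.get_entry (V .init)) <|
  .out (V .einit) (.tup ![V .nonce, V .s3, .tpm_ch (V .init), V .pp]) <|
  .out .cpu_tpm (.tup ![.ext_channel, .tpm_ch (V .init)]) cpuReturn

theorem safe_cpuCall {i k m s a q : Term} (hσ : σ.IsNormal β) (hn : Public (σ .nonce))
    (hx : σ .s2 = lockedState (launchReg (σ .init) m) i k m s a q) (hs : PublicParts i k m s a q)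
    (hi : Public (σ .init)) (hq : Public (σ .pp)) : (platformTyping β).Safe φ cpuCall σ := by
  refine safe_letin_destructor (mem_destructors (by simp)) fun y hy Hy => ?_
  obtain rfl : y = lockedState (launchReg (σ .init) m) i k m s (σ .init) q := by
    obtain ⟨x₁, x₂, x₃, a', q', l, _, e, -, rfl, rfl⟩ := Hy
    replace e : σ .s2 = state x₁ x₂ x₃ (drt a' q' l) := by simpa [hσ _] using e
    obtain ⟨rfl, rfl, rfl, -, rfl, rfl⟩ :
        _ = x₁ ∧ _ = x₂ ∧ _ = x₃ ∧ _ = a' ∧ _ = q' ∧ _ = l := by simpa using hx.symm.trans e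
    simp [hσ _]
  refine ⟨?_, safe_letin_destructor (mem_destructors (by simp)) fun e he He => ?_⟩
  · simp [Term.Closed, Fin.forall_fin_succ, hs.int.closed, hs.cache.closed, hs.stm.closed,
      hs.smi.closed, hs.pp.closed, hi.closed]
  replace He : σ .init = prog e := by simpa [Redex, hσ _] using He
  rw [He] at hi hy
  have Hcall : Msg φ e (tup ![σ .nonce, lockedState (launchReg (prog e) m) i k m s (prog e) q,
      tpm_ch (prog e), σ .pp]) :=
    .call_of_prog hi hn ⟨hs.int, hs.cache, hs.stm, hs.smi, hi, hs.pp⟩ hq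
  refine ⟨hi.closed 0, safe_out.2 ⟨?_, safe_out.2 ⟨?_, ?_⟩⟩⟩
  · simpa [he, hy, hσ _, He] using Hcall
  · simpa [He, he] using Msg.ext_channel (φ := φ) hi
  · exact safe_cpuReturn ((hσ.update _ (He ▸ hy)).update _ he)

/-- The part of the processor `cpuProc` after the state has been locked: the TPM resets the register
and extends it by the measurement. -/
def cpuMeasure : Proc :=
  .new .nonce .nonce <|
  .out .cpu_tpm (.tup ![.reset_req, V .nonce, V .s0]) <|
  .inp .cpu_tpm (.tup ![.eq .reset_resp, .eq (V .nonce), .bind .s1]) <|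
  .out .cpu_tpm (.tup ![.extend_req, V .nonce, V .s1, V .measure]) <|
  .inp .cpu_tpm (.tup ![.eq .extend_resp, .eq (V .nonce), .bind .s2]) cpuCall

theorem safe_cpuMeasure {p i k m s a q : Term} (hσ : σ.IsNormal β) (hp : Public p)
    (hx : σ .s0 = lockedState p i k m s a q) (hs : PublicParts i k m s a q)
    (hi : Public (σ .init)) (hq : Public (σ .pp))
    (hm : σ .measure = tup ![h (σ .init), h m]) : (platformTyping β).Safe φ cpuMeasure σ := by
  intro n hl hφ
  replace hφ : φ n = tup ![h (σ .init), h m] := by simpa [platformTyping, hl, hm] using hφ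
  have Hreset : Msg φ cpu_tpm (tup ![reset_req, .name n, σ .s0]) := hx ▸ .reset_req hp hs hi hφ
  refine safe_out.2 ⟨by simpa [hσ _] using Hreset, safe_inp fun τ₁ hτ₁ H₁ => ?_⟩
  replace H₁ : Msg φ cpu_tpm (tup ![reset_resp, .name n, τ₁ .s1]) := by simpa [hτ₁ _] using H₁
  obtain ⟨i₁, k₁, s₁, a₁, q₁, hx₁, hs₁⟩ := H₁.reset_resp_inv hφ
  have Hextend : Msg φ cpu_tpm (tup ![extend_req, .name n, τ₁ .s1, σ .measure]) := by
    rw [hx₁, hm]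
    exact .launch_req hs₁ hi hφ
  refine safe_out.2 ⟨by simpa [hσ _, hτ₁ _] using Hextend, safe_inp fun τ₂ hτ₂ H₂ => ?_⟩
  replace H₂ : Msg φ cpu_tpm (tup ![extend_resp, .name n, τ₂ .s2]) := by simpa [hτ₂ _] using H₂
  obtain ⟨i₂, k₂, s₂, a₂, q₂, hx₂, hs₂⟩ := H₂.launch_resp_inv hφ
  have hn : Public (.name n) := .name (by simp [hl])
  exact safe_cpuCall (((hσ.update _ (by simp)).override hτ₁ _).override hτ₂ _)
    (by simpa using hn) (by simpa using hx₂) hs₂ (by simpa using hi) (by simpa using hq)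

/-- The part of the processor `cpuProc` after the request has been accepted: it disables interrupts,
locks the state and computes the measurement. -/
def cpuLock : Proc :=
  .letin .s0' (.set_int (V .pf_state) .cpu_acc .ff) <|
  .letin .s0 (.set_lock (V .s0') .cpu_acc .tt) <|
  .letin .measure (.tup ![.h (V .init), .h (.stm (V .pf_state))]) cpuMeasure

theorem safe_cpuLock {p i k m s a q : Term} (hσ : σ.IsNormal β)
    (hx : σ .pf_state = state (tpm p) (cpu i k) (smram m s) (drt a q ff)) (hp : Public p)
    (hs : PublicParts i k m s a q) (hi : Public (σ .init)) (hq : Public (σ .pp)) :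
    (platformTyping β).Safe φ cpuLock σ := by
  refine safe_letin_destructor (mem_destructors (by simp)) fun y hy Hy => ?_
  obtain rfl : y = state (tpm p) (cpu ff k) (smram m s) (drt a q ff) := by
    obtain ⟨x₁, j, k', x₂, x₃, _, _, e, -, rfl, -, rfl⟩ := Hy
    replace e : σ .pf_state = state x₁ (cpu j k') x₂ x₃ := by simpa [hσ _] using e
    obtain ⟨rfl, ⟨-, rfl⟩, rfl, rfl⟩ : _ = x₁ ∧ (_ = j ∧ _ = k') ∧ _ = x₂ ∧ _ = x₃ := by
      simpa using hx.symm.trans e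
    simp
  refine ⟨?_, safe_letin_destructor (mem_destructors (by simp)) fun y' hy' Hy' => ?_⟩
  · simp [Term.Closed, Fin.forall_fin_succ, hp.closed, hs.cache.closed, hs.stm.closed,
      hs.smi.closed, hs.init.closed, hs.pp.closed]
  obtain rfl : y' = lockedState p ff k m s a q := by
    obtain ⟨x₁, x₂, x₃, a', q', l, _, _, e, -, rfl, -, rfl⟩ := Hy'
    replace e : state (tpm p) (cpu ff k) (smram m s) (drt a q ff) =
        state x₁ x₂ x₃ (drt a' q' l) := by simpa [hy] using e
    obtain ⟨rfl, rfl, rfl, rfl, rfl, -⟩ :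
        _ = x₁ ∧ _ = x₂ ∧ _ = x₃ ∧ _ = a' ∧ _ = q' ∧ _ = l := by simpa using e
    simp
  refine ⟨?_, safe_letin (v := tup ![h (σ .init), h m]) ?_ (hi.h.pair hs.stm.h).closed ?_⟩
  · simp [Term.Closed, Fin.forall_fin_succ, hp.closed, hs.cache.closed, hs.stm.closed,
      hs.smi.closed, hs.init.closed, hs.pp.closed]
  · simp [hσ _, nf_stm_of_eq_state ((hσ _).trans hx)]
  have hm : nf (platformTheory β) m = m := by
    rw [← nf_stm_of_eq_state ((hσ _).trans hx), nf_nf]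
  exact safe_cpuMeasure (i := ff) (m := m)
    (((hσ.update _ hy).update _ hy').update _ (by simp [hσ _, hm])) hp (by simp)
    ⟨by simp, hs.cache, hs.stm, hs.smi, hs.init, hs.pp⟩ (by simpa using hi) (by simpa using hq)
    (by simp)

theorem safe_cpuProc (hσ : σ.IsNormal β) : (platformTyping β).Safe φ cpuProc σ := by
  refine safe_inp fun τ hτ Hreq => ⟨fun hlock => ?_, fun _ => trivial⟩
  replace Hreq : Msg φ os (tup ![drt_req, τ .init, τ .pp, τ .pf_state]) := by
    simpa [hτ _] using Hreq
  obtain ⟨hi, hq, hx⟩ : Public (τ .init) ∧ Public (τ .pp) ∧ Public (τ .pf_state) := by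
    simpa [Fin.forall_fin_succ] using Hreq.public_of_os
  obtain ⟨_, _, _, _, _, e⟩ := redex_of_nf_app (f := .lock) (r := ff) (by simpa using hlock)
    (by simp)
  replace e : τ .pf_state = _ := (hτ _).symm.trans (by simpa using e)
  obtain ⟨p, i, k, m, s, a, q, l, ⟨rfl, rfl, rfl, hd⟩, hp, hint, hk, hm, hs, ha, hq', -⟩ :=
    (e ▸ hx).state_inv
  rw [hd] at e
  obtain ⟨-, -, rfl⟩ : _ ∧ _ ∧ ff = l := by simpa using hd
  exact safe_cpuLock (hσ.override hτ _) (by simpa using e) hp ⟨hint, hk, hm, hs, ha, hq'⟩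
    (by simpa using hi) (by simpa using hq)

theorem safe_execProc (hσ : σ.IsNormal β) : (platformTyping β).Safe φ execProc σ :=
  ⟨safe_cpuProc hσ, safe_initProc, safe_setupProc, safe_dataProc, safe_ppProc hσ⟩

theorem safe_DRT (hσ : σ.IsNormal β) : (platformTyping β).Safe φ DRT σ :=
  ⟨safe_tpmProc hσ fun _ => safe_pcrExtend, safe_execProc hσ⟩

theorem safe_DRTb (hb : 2 ≤ b) (hσ : σ.IsNormal (some b)) :
    (platformTyping (some b)).Safe φ DRTb σ :=
  ⟨safe_tpmProc hσ fun _ => safe_pcrExtendB hb, safe_execProc hσ⟩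

end Protocol

section Properties

open Term

attribute [local simp] Sym.isDestructor

variable {β : Option ℕ} {P : Proc}

theorem public_of_att (hP : ∀ φ, (platformTyping β).Safe φ P .var) {T : Term}
    (H : Att (platformTheory β) P T) : Public (nf (platformTheory β) T) :=
  MessageTyping.pub_of_att (isConstructorTheory_platformTheory β)
    (fun _ => not_mem_destructors rfl) hP H

theorem sat_phiSec (hP : ∀ φ, (platformTyping β).Safe φ P .var) :
    Sat (platformTheory β) P PhiSec := by
  rintro _ ⟨i, rfl⟩ σ hatt
  exact not_public_name_kpp i (by simpa [Term.subst] using public_of_att hP hatt)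

theorem sat_phiInt (hP : ∀ φ, (platformTyping β).Safe φ P .var) :
    Sat (platformTheory β) P PhiInt := by
  rintro _ rfl σ hatt
  have hpub : Public (state (tpm hchain)
      (cpu (nf (platformTheory β) (σ .xint)) (nf (platformTheory β) (σ .xcache)))
      (smram (nf (platformTheory β) (σ .xstm)) (nf (platformTheory β) (σ .xsmi)))
      (drt (nf (platformTheory β) (σ .xinit)) (nf (platformTheory β) (σ .xpp)) tt)) := by
    simpa [hchain_eq] using public_of_att hP hatt
  obtain ⟨hstm, hinit, hpp, -⟩ := (public_state.1 hpub).2.2.2.2.2.2.2.2.trusted rfl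
  simp [holdsConcl, EqE, hstm, hinit, hpp]

theorem sat_of_safe (hP : ∀ φ, (platformTyping β).Safe φ P .var) {Φ : Property}
    (hΦ : Φ ∈ ({PhiSec, PhiInt} : Set Property)) : Sat (platformTheory β) P Φ := by
  rcases hΦ with rfl | rfl
  · exact sat_phiSec hP
  · exact sat_phiInt hP

end Properties

end Drt

theorem mainTheorem2 (b : ℕ) (hb : 2 ≤ b) (Φ : Drt.Property)
    (hΦ : Φ ∈ ({Drt.PhiSec, Drt.PhiInt} : Set Drt.Property)) :
    Drt.Sat Drt.Edrt Drt.DRT Φ ↔ Drt.Sat (Drt.Edrtb b) Drt.DRTb Φ :=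
  iff_of_true
    (Drt.sat_of_safe (β := none) (fun _ => Drt.safe_DRT Drt.nf_var) hΦ)
    (Drt.sat_of_safe (β := some b) (fun _ => Drt.safe_DRTb hb Drt.nf_var) hΦ)
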